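/- Let \(\upsilon>0\) be a real number and let \((t_m)_{m\in\mathbb N}\) be a strictly monotone (strictly increasing or strictly decreasing) sequence of reals with \(t_m\to 0\) and \(\upsilon+t_0>0\). Put \(S=\{\upsilon+t_m : m\in\mathbb N\}\subseteq\mathbb R^{>0}\). Then every free Borel flow \(\mathbb R\curvearrowright\Omega\), i.e. every free, jointly Borel measurable action \((\omega,r)\mapsto\omega+r\) of \(\mathbb R\) on a standard Borel space \(\Omega\), admits a cross section \(\mathcal C\) that has arbitrarily large \(\mathsf E^{S}_{\mathcal C}\)-classes within every orbit: for every orbit \(O\) and every \(n\in\mathbb N\) there is \(x\in\mathcal C\cap O\) whose \(\mathsf E^{S}_{\mathcal C}\)-class has at least \(n\) elements. Here a cross section is a Borel set \(\mathcal C\subseteq\Omega\) that meets every orbit, is lacunary (there is \(c>0\) such that \(x\in\mathcal C\), \(r>0\) and \(x+r\in\mathcal C\setminus\{x\}\) imply \(r\ge c\)), and is bi-infinite (every \(x\in\mathcal C\) has a successor and a predecessor in \(\mathcal C\) on its orbit). For \(x\in\mathcal C\), \(\phi_{\mathcal C}(x)\) denotes the successor of \(x\), and the gap at \(x\) is the \(r>0\)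 with \(x+r=\phi_{\mathcal C}(x)\). Points \(x,y\in\mathcal C\) are \(\mathsf E^{S}_{\mathcal C}\)-equivalent if there is \(n\ge 0\) such that \(\phi_{\mathcal C}^{n}(x)=y\) and the gaps at \(\phi_{\mathcal C}^{k}(x)\), \(0\le k<n\), all belong to \(S\), or the same holds with \(x\) and \(y\) interchanged. -/

import Mathlib

open Set Filter Topology

namespace BorelFlow

/-- An action of the additive group of reals is free if only `0` fixes a point. A Borel flow on a
standard Borel space is an action that is jointly measurable (`MeasurableVAdd₂ ℝ Ω`); the point
written `ω + r` on paper is `r +ᵥ ω` here. -/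
def IsFree (Ω : Type*) [AddAction ℝ Ω] : Prop :=
  ∀ (r : ℝ) (ω : Ω), r +ᵥ ω = ω → r = 0

/-- A (bi-infinite) cross section of a flow: a Borel set that meets every orbit, is lacunary (with
one lower bound `c` for the distances between its points), and in which every point has points of
the set both after it and before it on its orbit. Given lacunarity, the last two clauses say that
every point has a successor and a predecessor. -/
structure IsCrossSection {Ω : Type*} [MeasurableSpace Ω] [AddAction ℝ Ω] (C : Set Ω) : Prop where
  measurableSet : MeasurableSet C
  meets_orbit : ∀ ω : Ω, (AddAction.orbit ℝ ω ∩ C).Nonempty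
  lacunary : ∃ c : ℝ, 0 < c ∧ ∀ x ∈ C, ∀ r : ℝ, 0 < r → r +ᵥ x ∈ C \ {x} → c ≤ r
  exists_after : ∀ x ∈ C, ∃ r : ℝ, 0 < r ∧ r +ᵥ x ∈ C
  exists_before : ∀ x ∈ C, ∃ r : ℝ, 0 < r ∧ (-r) +ᵥ x ∈ C

/-- The gap function: the distance from `x` to the next point of `C` on the orbit of `x`. For a
cross section of a free flow and `x ∈ C` the infimum is a minimum, see
`IsCrossSection.isLeast_gap`. -/
noncomputable def gap {Ω : Type*} [AddAction ℝ Ω] (C : Set Ω) (x : Ω) : ℝ :=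
  sInf {r : ℝ | 0 < r ∧ r +ᵥ x ∈ C}

/-- The induced map, which sends a point of `C` to the next point of `C`. -/
noncomputable def next {Ω : Type*} [AddAction ℝ Ω] (C : Set Ω) (x : Ω) : Ω :=
  gap C x +ᵥ x

theorem IsCrossSection.isLeast_gap {Ω : Type*} [MeasurableSpace Ω] [AddAction ℝ Ω] {C : Set Ω}
    (hfree : IsFree Ω) (hC : IsCrossSection C) {x : Ω} (hx : x ∈ C) :
    IsLeast {r : ℝ | 0 < r ∧ r +ᵥ x ∈ C} (gap C x) := by
  obtain ⟨c, hc, hlac⟩ := hC.lacunary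
  obtain ⟨r₀, hr₀⟩ := hC.exists_after x hx
  have hne : {r : ℝ | 0 < r ∧ r +ᵥ x ∈ C}.Nonempty := ⟨r₀, hr₀⟩
  have hbdd : BddBelow {r : ℝ | 0 < r ∧ r +ᵥ x ∈ C} := ⟨0, fun r hr => hr.1.le⟩
  have hlow : ∀ b ∈ {r : ℝ | 0 < r ∧ r +ᵥ x ∈ C}, gap C x ≤ b := fun b hb => csInf_le hbdd hb
  refine ⟨?_, hlow⟩
  obtain ⟨a, ha, hac⟩ := exists_lt_of_csInf_lt hne
    (show sInf {r : ℝ | 0 < r ∧ r +ᵥ x ∈ C} < gap C x + c from lt_add_of_pos_right _ hc)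
  rcases (hlow a ha).eq_or_lt with h | h
  · rw [h]; exact ha
  · exfalso
    obtain ⟨b, hb, hba⟩ := exists_lt_of_csInf_lt hne h
    have hmem : (a - b) +ᵥ (b +ᵥ x) ∈ C \ {b +ᵥ x} := by
      refine ⟨?_, fun h' => ?_⟩
      · rw [vadd_vadd, sub_add_cancel]; exact ha.2
      · linarith [hfree _ _ h']
    have h1 := hlac _ hb.2 (a - b) (by linarith) hmem
    linarith [hlow b hb]

/-- `y` is reached from `x` by finitely many (possibly zero) steps to the next point of `C`, all of
the gaps passed on the way belonging to `S`. -/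
def Reaches {Ω : Type*} [AddAction ℝ Ω] (S : Set ℝ) (C : Set Ω) (x y : Ω) : Prop :=
  ∃ n : ℕ, (next C)^[n] x = y ∧ ∀ k < n, gap C ((next C)^[k] x) ∈ S

/-- The relation on `C` that holds between `x` and `y` if all gaps of `C` between them are in
`S`. -/
def BlockRel {Ω : Type*} [AddAction ℝ Ω] (S : Set ℝ) (C : Set Ω) (x y : Ω) : Prop :=
  x ∈ C ∧ y ∈ C ∧ (Reaches S C x y ∨ Reaches S C y x)

/-- The class (block) of `x` under `BlockRel S C`. -/
def block {Ω : Type*} [AddAction ℝ Ω] (S : Set ℝ) (C : Set Ω) (x : Ω) : Set Ω :=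
  {y | BlockRel S C x y}

/-- `C` has arbitrarily large `S`-blocks within every orbit: each orbit contains, for every `n`, a
point of `C` whose block has at least `n` elements (it may be infinite). -/
def HasArbitrarilyLargeBlocks {Ω : Type*} [AddAction ℝ Ω] (S : Set ℝ) (C : Set Ω) : Prop :=
  ∀ ω : Ω, ∀ n : ℕ, ∃ x ∈ AddAction.orbit ℝ ω ∩ C, (n : ℕ∞) ≤ (block S C x).encard

end BorelFlow

/-! Let `s` consist of values of |t| with s(n+1) ≤ s(n)/4. Take a cross section for which δ = ±(gap
− υ) lies in [s(2), s(1)] throughout, with successor map T. Moving each point x by ±H(x) replaces δ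
by δ + H∘T − H. So it suffices to find, for an aperiodic Borel automorphism, a small bounded H such
that each orbit has arbitrarily long runs on which the new lengths are values of `s`
(`exists_coboundary`).

H is a sum of displacements h_n. At stage n the lengths are already values of `s` off a syndetic set
B_n with spacing at least n, and lie in [s(n+2), s(n+1)] on B_n. Stretches between visits to B_n
move rigidly, so correct lengths survive. A sparser B_{n+1} ⊆ B_n cuts each orbit into blocks
(`exists_displacement`): the excess over s(n+3) gathered in a block is paid out in coins s(n) −
s(n+3), what then remains in coins s(n+2) − s(n+3), and a residue below one small coin goes to the
point of B_{n+1} ending the block. Its length then lies in [s(n+3), s(n+2)], as the next stage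
requires. Since |h_n| ≤ s(n), the sum converges; lengths off B_n are final, and the runs avoiding
B_n grow.

The initial cross section comes from a syndetic lacunary Borel set (`exists_lacunary_syndetic`),
obtained from level crossings of occupation times, whose gaps are then cut into equal parts. -/

namespace BorelFlow

/-! ### Countable separation and greedy independent sets -/

theorem exists_separating_sets (X : Type*) [MeasurableSpace X] [StandardBorelSpace X] :
    ∃ U : ℕ → Set X, (∀ n, MeasurableSet (U n)) ∧
      ∀ (x : X) (F : Set X), F.Finite → x ∉ F → ∃ n, x ∈ U n ∧ ∀ y ∈ F, y ∉ U n := by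
  obtain ⟨f, hf⟩ := MeasureTheory.exists_measurableEmbedding_real X
  obtain ⟨b, hbc, hbe, hb⟩ := TopologicalSpace.exists_countable_basis ℝ
  have hne : b.Nonempty := by
    obtain ⟨v, hv, -⟩ := hb.exists_subset_of_mem_open (mem_univ (0 : ℝ)) isOpen_univ
    exact ⟨v, hv⟩
  obtain ⟨V, hV⟩ := hbc.exists_eq_range hne
  refine ⟨fun n => f ⁻¹' V n, fun n => ?_, fun x F hF hx => ?_⟩
  · exact hf.measurable (hb.isOpen (hV ▸ mem_range_self n)).measurableSet
  -- Finite subsets of ℝ are closed, so a basic neighbourhood of `f x` misses `f '' F`.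
  · have hx' : f x ∈ (f '' F)ᶜ := by
      rintro ⟨y, hy, hyx⟩
      exact hx (hf.injective hyx ▸ hy)
    obtain ⟨v, hv, hxv, hvF⟩ := hb.exists_subset_of_mem_open hx' (hF.image f).isClosed.isOpen_compl
    obtain ⟨n, rfl⟩ := hV ▸ hv
    exact ⟨n, hxv, fun y hy hyn => hvF hyn (mem_image_of_mem f hy)⟩

/-- A Borel maximal independent set, chosen greedily from a sequence of independent sets. -/
theorem exists_measurableSet_independent {X : Type*} [MeasurableSpace X] (near : X → X → Prop)
    (hrefl : ∀ x, near x x) (hsymm : ∀ x y, near x y → near y x)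
    (hmeas : ∀ M : Set X, MeasurableSet M → M.Pairwise (fun x y => ¬ near x y) →
      MeasurableSet {x | ∃ y ∈ M, near x y})
    (A : ℕ → Set X) (hA : ∀ n, MeasurableSet (A n))
    (hind : ∀ n, (A n).Pairwise (fun x y => ¬ near x y)) :
    ∃ M : Set X, MeasurableSet M ∧ M ⊆ ⋃ n, A n ∧ M.Pairwise (fun x y => ¬ near x y) ∧
      ∀ n, ∀ x ∈ A n, ∃ y ∈ M, near x y := by
  let W : ℕ → Set X := fun n =>
    Nat.rec ∅ (fun n M => M ∪ (A n \ {x | ∃ y ∈ M, near x y})) n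
  have hW : ∀ n, W (n + 1) = W n ∪ (A n \ {x | ∃ y ∈ W n, near x y}) := fun n => rfl
  -- Independence is carried along with measurability because `hmeas` applies to independent sets
  -- only.
  have hprop : ∀ n, MeasurableSet (W n) ∧ (W n).Pairwise (fun x y => ¬ near x y) ∧
      W n ⊆ ⋃ n, A n := by
    intro n
    induction n with
    | zero => exact ⟨MeasurableSet.empty, pairwise_empty _, empty_subset _⟩
    | succ n ih =>
      obtain ⟨h1, h2, h3⟩ := ih
      rw [hW]
      refine ⟨h1.union ((hA n).diff (hmeas _ h1 h2)), ?_, union_subset h3 ?_⟩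
      · rintro x (hx | hx) y (hy | hy) hxy hn
        · exact h2 hx hy hxy hn
        · exact hy.2 ⟨x, hx, hsymm _ _ hn⟩
        · exact hx.2 ⟨y, hy, hn⟩
        · exact hind n hx.1 hy.1 hxy hn
      · exact sdiff_subset.trans (subset_iUnion A n)
  have hmono : Monotone W := monotone_nat_of_le_succ fun n => by
    rw [hW]; exact subset_union_left
  refine ⟨⋃ n, W n, MeasurableSet.iUnion fun n => (hprop n).1,
    iUnion_subset fun n => (hprop n).2.2, ?_, ?_⟩
  · intro x hx y hy hxy
    obtain ⟨m, hm⟩ := mem_iUnion.1 hx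
    obtain ⟨n, hn⟩ := mem_iUnion.1 hy
    exact (hprop (max m n)).2.1 (hmono (le_max_left m n) hm) (hmono (le_max_right m n) hn) hxy
  · intro n x hx
    rcases em (∃ y ∈ W n, near x y) with ⟨y, hy, hn⟩ | h
    · exact ⟨y, mem_iUnion.2 ⟨n, hy⟩, hn⟩
    · exact ⟨x, mem_iUnion.2 ⟨n + 1, by rw [hW]; exact Or.inr ⟨hx, h⟩⟩, hrefl x⟩

end BorelFlow

/-! ### Syndetic sets of a Borel automorphism -/

namespace BorelFlow

section Automorphism

variable {X : Type*} [MeasurableSpace X]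

/-- Every point enters `B` within a bounded number of forward steps of `T`. -/
def IsSyndetic (T : X ≃ᵐ X) (B : Set X) : Prop :=
  ∃ N : ℕ, ∀ x, ∃ j < N, (⇑T)^[j] x ∈ B

theorem iterate_apply_symm (T : X ≃ᵐ X) (n : ℕ) (x : X) : (⇑T)^[n] ((⇑T.symm)^[n] x) = x :=
  (Function.LeftInverse.iterate (fun y => T.apply_symm_apply y) n) x

theorem iterate_symm_apply (T : X ≃ᵐ X) (n : ℕ) (x : X) : (⇑T.symm)^[n] ((⇑T)^[n] x) = x :=
  (Function.LeftInverse.iterate (fun y => T.symm_apply_apply y) n) x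

/-- By aperiodicity, each point of B is separated by some `U n` from its next L iterates, so B is a
countable union of sets without returns within time L. A greedy choice among these is sparse, and
its maximality keeps it syndetic. -/
theorem exists_sparse_subset [StandardBorelSpace X] (T : X ≃ᵐ X)
    (haper : ∀ x, ∀ n : ℕ, 0 < n → (⇑T)^[n] x ≠ x) {B : Set X} (hB : MeasurableSet B)
    (hsyn : IsSyndetic T B) (L : ℕ) :
    ∃ B' ⊆ B, MeasurableSet B' ∧ IsSyndetic T B' ∧
      ∀ x ∈ B', ∀ j : ℕ, 0 < j → (⇑T)^[j] x ∈ B' → L < j := by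
  obtain ⟨U, hU, hsep⟩ := exists_separating_sets X
  have hT : ∀ j : ℕ, Measurable (⇑T)^[j] := fun j => T.measurable.iterate j
  have hT' : ∀ j : ℕ, Measurable (⇑T.symm)^[j] := fun j => T.symm.measurable.iterate j
  let near : X → X → Prop := fun x y => ∃ j ≤ L, (⇑T)^[j] x = y ∨ (⇑T)^[j] y = x
  let A : ℕ → Set X := fun n => (B ∩ U n) \ ⋃ j ∈ Finset.Icc 1 L, (⇑T)^[j] ⁻¹' (U n)
  have hAind : ∀ n x, x ∈ A n → ∀ j ≤ L, (⇑T)^[j] x ∈ A n → j = 0 := by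
    intro n x hx j hj hjx
    by_contra h0
    refine hx.2 (mem_biUnion (x := j) ?_ hjx.1.2)
    simp only [Finset.coe_Icc, mem_Icc]
    omega
  obtain ⟨M, hM, hMA, hMind, hMmax⟩ := exists_measurableSet_independent near
    (fun x => ⟨0, Nat.zero_le _, Or.inl rfl⟩)
    (fun x y ⟨j, hj, h⟩ => ⟨j, hj, h.symm⟩)
    (by
      intro M hM _
      have : {x | ∃ y ∈ M, near x y} =
          ⋃ j ∈ Finset.range (L + 1), ((⇑T)^[j] ⁻¹' M ∪ (⇑T.symm)^[j] ⁻¹' M) := by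
        ext x
        simp only [mem_ofPred_eq, mem_iUnion, Finset.mem_range, mem_union, mem_preimage, near,
          exists_prop, Nat.lt_succ_iff]
        constructor
        · rintro ⟨y, hy, j, hj, rfl | rfl⟩
          · exact ⟨j, hj, Or.inl hy⟩
          · exact ⟨j, hj, Or.inr (by rwa [iterate_symm_apply])⟩
        · rintro ⟨j, hj, h | h⟩
          · exact ⟨_, h, j, hj, Or.inl rfl⟩
          · exact ⟨_, h, j, hj, Or.inr (iterate_apply_symm T j x)⟩
      rw [this]
      exact Finset.measurableSet_biUnion _ fun j _ => (hT j hM).union (hT' j hM))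
    A
    (fun n => (hB.inter (hU n)).diff
      (Finset.measurableSet_biUnion _ fun j _ => hT j (hU n)))
    (by
      rintro n x hx y hy hxy ⟨j, hj, rfl | rfl⟩
      · exact hxy (by rw [hAind n x hx j hj hy]; rfl)
      · exact hxy (by rw [hAind n y hy j hj hx]; rfl))
  have hMB : M ⊆ B := fun x hx => by
    obtain ⟨n, hn⟩ := mem_iUnion.1 (hMA hx)
    exact hn.1.1
  refine ⟨M, hMB, hM, ?_, ?_⟩
  · obtain ⟨N, hN⟩ := hsyn
    refine ⟨N + L + L + 1, fun x => ?_⟩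
    -- Starting L steps ahead ensures that a selected point up to L steps before y is still on the
    -- forward orbit of x.
    obtain ⟨i, hi, hiB⟩ := hN ((⇑T)^[L] x)
    set y := (⇑T)^[i] ((⇑T)^[L] x) with hy
    have hy' : y = (⇑T)^[i + L] x := by rw [hy, Function.iterate_add_apply]
    obtain ⟨n, hn, hnF⟩ := hsep y ((fun j => (⇑T)^[j] y) '' (Finset.Icc 1 L : Finset ℕ))
      ((Finset.finite_toSet _).image _) (by
        rintro ⟨j, hj, h⟩
        simp only [Finset.coe_Icc, mem_Icc] at hj
        exact haper y j (by omega) h)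
    have hyA : y ∈ A n := by
      refine ⟨⟨hiB, hn⟩, fun h => ?_⟩
      obtain ⟨j, hj, hjU⟩ := mem_iUnion₂.1 h
      exact hnF _ ⟨j, hj, rfl⟩ hjU
    obtain ⟨z, hz, j, hj, h | h⟩ := hMmax n y hyA
    · refine ⟨j + (i + L), by omega, ?_⟩
      rw [Function.iterate_add_apply, ← hy', h]
      exact hz
    · refine ⟨i + L - j, by omega, ?_⟩
      have : (⇑T)^[j] ((⇑T)^[i + L - j] x) = (⇑T)^[j] z := by
        rw [h, hy', ← Function.iterate_add_apply, Nat.add_sub_of_le (by omega)]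
      rw [T.injective.iterate j this]
      exact hz
  · intro x hx j hj hjx
    by_contra h
    exact hMind hx hjx (haper x j hj).symm ⟨j, by omega, Or.inl rfl⟩

theorem exists_last_visit (T : X ≃ᵐ X) {B : Set X} (hsyn : IsSyndetic T B) (x : X) :
    ∃ r : ℕ, ∃ p ∈ B, (⇑T)^[r + 1] p = x ∧ ∀ j, 0 < j → j ≤ r → (⇑T)^[j] p ∉ B := by
  classical
  obtain ⟨N, hN⟩ := hsyn
  have hex : ∃ r : ℕ, (⇑T.symm)^[r + 1] x ∈ B := by
    obtain ⟨j, hj, hjB⟩ := hN ((⇑T.symm)^[N] x)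
    refine ⟨N - j - 1, ?_⟩
    rw [show N = j + (N - j - 1 + 1) by omega, Function.iterate_add_apply,
      iterate_apply_symm] at hjB
    exact hjB
  refine ⟨Nat.find hex, _, Nat.find_spec hex, iterate_apply_symm T _ x, fun j hj hjr hjB => ?_⟩
  refine Nat.find_min hex (m := Nat.find hex - j) (by omega) ?_
  rw [show Nat.find hex + 1 = j + (Nat.find hex - j + 1) by omega, Function.iterate_add_apply,
    iterate_apply_symm] at hjB
  exact hjB

theorem measurable_natIndexed {Y : Type*} [MeasurableSpace Y] {r : X → ℕ} (hr : Measurable r)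
    {f : ℕ → X → Y} (hf : ∀ n, Measurable (f n)) : Measurable fun x => f (r x) x :=
  (measurable_from_prod_countable_right (f := fun p : ℕ × X => f p.1 p.2) hf).comp
    (hr.prodMk measurable_id)

/-- Sums of `f` along `T`, restarted after each visit to `B`. -/
theorem exists_measurable_resetSum (T : X ≃ᵐ X) {B : Set X} (hB : MeasurableSet B)
    (hsyn : IsSyndetic T B) {G : Type*} [AddCommMonoid G] [MeasurableSpace G] [MeasurableAdd₂ G]
    {f : X → G} (hf : Measurable f) :
    ∃ S : X → G, Measurable S ∧ (∀ x ∈ B, S (T x) = f x) ∧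
      ∀ x ∉ B, S (T x) = S x + f x := by
  classical
  have hex : ∀ x, ∃ r : ℕ, (⇑T.symm)^[r + 1] x ∈ B := fun x => by
    obtain ⟨r, p, hp, rfl, -⟩ := exists_last_visit T hsyn x
    exact ⟨r, by rwa [iterate_symm_apply]⟩
  have hT' : ∀ j : ℕ, Measurable (⇑T.symm)^[j] := fun j => T.symm.measurable.iterate j
  have hback : ∀ (x : X) (j : ℕ), (⇑T.symm)^[j + 1] (T x) = (⇑T.symm)^[j] x := fun x j => by
    rw [Function.iterate_succ_apply, T.symm_apply_apply]
  refine ⟨fun x => ∑ j ∈ Finset.range (Nat.find (hex x) + 1), f ((⇑T.symm)^[j + 1] x),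
    measurable_natIndexed (r := fun x => Nat.find (hex x))
      (f := fun n x => ∑ j ∈ Finset.range (n + 1), f ((⇑T.symm)^[j + 1] x))
      (measurable_find hex fun k => hT' (k + 1) hB)
      fun n => Finset.measurable_fun_sum _ fun j _ => hf.comp (hT' (j + 1)), ?_, ?_⟩
  · intro x hx
    have : Nat.find (hex (T x)) = 0 := by
      rw [Nat.find_eq_zero, hback]
      exact hx
    simp only [this, zero_add, Finset.range_one, Finset.sum_singleton]
    rw [hback x 0]
    rfl
  · intro x hx
    have : Nat.find (hex (T x)) = Nat.find (hex x) + 1 := by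
      rw [Nat.find_eq_iff]
      refine ⟨by rw [hback]; exact Nat.find_spec (hex x), fun n hn => ?_⟩
      rw [hback]
      rcases n with _ | n
      · exact hx
      · exact Nat.find_min (hex x) (by omega)
    simp only [this]
    rw [Finset.sum_range_succ']
    simp only [hback]
    rfl

/-- The value of `f` at the next visit to `B`. -/
theorem exists_measurable_nextValue (T : X ≃ᵐ X) {B : Set X} (hB : MeasurableSet B)
    (hsyn : IsSyndetic T B) {Y : Type*} [MeasurableSpace Y] {f : X → Y} (hf : Measurable f) :
    ∃ g : X → Y, Measurable g ∧ (∀ x ∈ B, g x = f x) ∧ (∀ x ∉ B, g (T x) = g x) ∧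
      ∀ x, ∃ y, g x = f y := by
  classical
  have hex : ∀ x, ∃ r : ℕ, (⇑T)^[r] x ∈ B := fun x => by
    obtain ⟨N, hN⟩ := hsyn
    obtain ⟨j, -, hj⟩ := hN x
    exact ⟨j, hj⟩
  have hT : ∀ j : ℕ, Measurable (⇑T)^[j] := fun j => T.measurable.iterate j
  refine ⟨fun x => f ((⇑T)^[Nat.find (hex x)] x),
    measurable_natIndexed (r := fun x => Nat.find (hex x)) (f := fun n x => f ((⇑T)^[n] x))
      (measurable_find hex fun k => hT k hB) fun n => hf.comp (hT n), ?_, ?_, fun x => ⟨_, rfl⟩⟩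
  · intro x hx
    have : Nat.find (hex x) = 0 := by rw [Nat.find_eq_zero]; exact hx
    simp only [this, Function.iterate_zero, id_eq]
  · intro x hx
    have : Nat.find (hex x) = Nat.find (hex (T x)) + 1 := by
      rw [Nat.find_eq_iff]
      refine ⟨Nat.find_spec (hex (T x)), fun n hn => ?_⟩
      rcases n with _ | n
      · exact hx
      · exact Nat.find_min (hex (T x)) (by omega)
    simp only [this]
    rfl

end Automorphism

end BorelFlow

/-! ### One correction stage -/

namespace BorelFlow

/-- The displacement after `i` steps with total excess `D`, when every excess `θ` accumulated is paid
at once, and `θ'` is paid at the first `a` of the remaining steps. -/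
noncomputable def displacement (θ θ' D : ℝ) (i a : ℤ) : ℝ :=
  -- The −1 excludes the first step of a block, which starts at a point of B'; the length there
  -- absorbs the residue of the preceding block instead.
  -D + θ * ⌊D / θ⌋ + θ' * (min (i - 1 - ⌊D / θ⌋) a : ℤ)

theorem excess_bounds {θ : ℝ} (hθ : 0 < θ) (D : ℝ) :
    0 ≤ D - θ * ⌊D / θ⌋ ∧ D - θ * ⌊D / θ⌋ < θ := by
  have h1 : θ * (D / θ) = D := mul_div_cancel₀ D hθ.ne'
  have h2 := mul_le_mul_of_nonneg_left (Int.floor_le (D / θ)) hθ.le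
  have h3 := mul_lt_mul_of_pos_left (Int.lt_floor_add_one (D / θ)) hθ
  constructor <;> linarith

/-- Here e is the excess of the corrected length over the base length. As d < θ, the floor rises by
at most one; when it does, the count of remaining steps stays put, so θ and θ' are never paid
together. -/
theorem displacement_step {θ : ℝ} (θ' : ℝ) (hθ : 0 < θ) {D d : ℝ} (hd : 0 ≤ d) (hd' : d ≤ θ / 2)
    (i a : ℤ) :
    let e := d + displacement θ θ' (D + d) (i + 1) a - displacement θ θ' D i a
    e = 0 ∨ e = θ ∨ e = θ' := by
  intro e
  have h1 : (D + d) / θ = D / θ + d / θ := add_div _ _ _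
  have hd1 : 0 ≤ d / θ := by positivity
  have hd2 : d / θ < 1 := by rw [div_lt_one hθ]; linarith
  have hf1 : ⌊D / θ⌋ ≤ ⌊(D + d) / θ⌋ := Int.floor_le_floor (by linarith)
  have hf2 : ⌊(D + d) / θ⌋ ≤ ⌊D / θ⌋ + 1 := by
    rw [← Int.floor_add_one]; exact Int.floor_le_floor (by linarith)
  rcases (show ⌊(D + d) / θ⌋ = ⌊D / θ⌋ ∨ ⌊(D + d) / θ⌋ = ⌊D / θ⌋ + 1 by omega) with h | h
  · rcases (show min (i + 1 - 1 - ⌊D / θ⌋) a = min (i - 1 - ⌊D / θ⌋) a ∨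
      min (i + 1 - 1 - ⌊D / θ⌋) a = min (i - 1 - ⌊D / θ⌋) a + 1 by omega) with h' | h'
    · left
      simp only [e, displacement, h, h']
      ring
    · right; right
      simp only [e, displacement, h, h']
      push_cast
      ring
  · right; left
    have h' : i + 1 - 1 - (⌊D / θ⌋ + 1) = i - 1 - ⌊D / θ⌋ := by ring
    simp only [e, displacement, h, h']
    push_cast
    ring

variable {X : Type*} [MeasurableSpace X]

/-- `i` counts visits to B since the last visit to B', and every window of N steps contains one. -/
theorem le_resetSum_indicator (T : X ≃ᵐ X) {B B' : Set X} {N : ℕ}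
    (hN : ∀ x, ∃ j < N, (⇑T)^[j] x ∈ B) {i : X → ℤ}
    (hi : ∀ x ∈ B', i (T x) = B.indicator 1 x)
    (hi' : ∀ x ∉ B', i (T x) = i x + B.indicator 1 x) {p : X} (hp : p ∈ B') (m : ℕ) :
    ∀ r, (∀ j, 0 < j → j ≤ r → (⇑T)^[j] p ∉ B') → N * m ≤ r + 1 → (m : ℤ) ≤ i ((⇑T)^[r + 1] p) := by
  have hcount : ∀ r, (∀ j, 0 < j → j ≤ r → (⇑T)^[j] p ∉ B') →
      i ((⇑T)^[r + 1] p) = ∑ j ∈ Finset.range (r + 1), B.indicator 1 ((⇑T)^[j] p) := by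
    intro r
    induction r with
    | zero =>
      intro _
      simpa using hi p hp
    | succ r ih =>
      intro h
      rw [Finset.sum_range_succ, ← ih fun j h0 hj => h j h0 (by omega),
        Function.iterate_succ_apply', hi' _ (h (r + 1) (by omega) le_rfl)]
  have hwin : ∀ m : ℕ, (m : ℤ) ≤ ∑ j ∈ Finset.range (N * m), B.indicator 1 ((⇑T)^[j] p) := by
    intro m
    induction m with
    | zero => simp
    | succ m ih =>
      rw [Nat.mul_succ, Finset.sum_range_add]
      have : (1 : ℤ) ≤ ∑ j ∈ Finset.range N, B.indicator 1 ((⇑T)^[N * m + j] p) := by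
        obtain ⟨j, hj, hjB⟩ := hN ((⇑T)^[N * m] p)
        rw [← Function.iterate_add_apply, add_comm] at hjB
        refine le_trans (le_of_eq ?_) (Finset.single_le_sum
          (f := fun j => B.indicator (1 : X → ℤ) ((⇑T)^[N * m + j] p))
          (fun k _ => indicator_nonneg (fun _ _ => zero_le_one) _) (Finset.mem_range.2 hj))
        simp [hjB]
      push_cast
      linarith
  intro r hr hm
  rw [hcount r hr]
  exact (hwin m).trans (Finset.sum_le_sum_of_subset_of_nonneg
    (Finset.range_subset_range.2 hm) fun k _ _ => indicator_nonneg (fun _ _ => zero_le_one) _)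

/-- Lengths in [τ, τ + θ/2] become exactly τ, τ + θ or τ + θ', except on a sparser set where the
error shrinks to at most θ'. -/
theorem exists_displacement [StandardBorelSpace X] (T : X ≃ᵐ X)
    (haper : ∀ x, ∀ n : ℕ, 0 < n → (⇑T)^[n] x ≠ x) {B : Set X} (hB : MeasurableSet B)
    (hsyn : IsSyndetic T B) {δ : X → ℝ} (hδ : Measurable δ) {θ θ' τ : ℝ} (hθ : 0 < θ)
    (hθ' : 0 < θ') (hδB : ∀ x ∈ B, τ ≤ δ x ∧ δ x ≤ τ + θ / 2) (L : ℕ) :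
    ∃ B' ⊆ B, MeasurableSet B' ∧ IsSyndetic T B' ∧
      (∀ x ∈ B', ∀ j : ℕ, 0 < j → (⇑T)^[j] x ∈ B' → L < j) ∧
      ∃ h : X → ℝ, Measurable h ∧ (∀ x, |h x| ≤ θ) ∧ (∀ x ∉ B, h (T x) = h x) ∧
        (∀ x ∈ B', τ ≤ δ x + h (T x) - h x ∧ δ x + h (T x) - h x ≤ τ + θ') ∧
        ∀ x ∈ B, x ∉ B' → δ x + h (T x) - h x = τ ∨ δ x + h (T x) - h x = τ + θ ∨
          δ x + h (T x) - h x = τ + θ' := by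
  obtain ⟨N, hN⟩ := id hsyn
  -- Since D ≤ iθ/2, at most half of the i steps pay θ. If i ≥ K, the remaining i/2 − 1 ≥ θ/θ' steps
  -- suffice for all payments of θ'.
  obtain ⟨K, hK⟩ := exists_nat_ge (2 * (θ / θ') + 2)
  obtain ⟨B', hB'B, hB', hsyn', hsep⟩ := exists_sparse_subset T haper hB hsyn (max L (N * (K + 1)))
  refine ⟨B', hB'B, hB', hsyn', fun x hx j hj hjx =>
    (le_max_left _ _).trans_lt (hsep x hx j hj hjx), ?_⟩
  have hsepN : ∀ x ∈ B', ∀ j : ℕ, 0 < j → (⇑T)^[j] x ∈ B' → N * (K + 1) < j :=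
    fun x hx j hj hjx => (le_max_right _ _).trans_lt (hsep x hx j hj hjx)
  obtain ⟨D, hDm, hD, hD'⟩ := exists_measurable_resetSum T hB' hsyn'
    (f := B.indicator fun x => δ x - τ) ((hδ.sub_const τ).indicator hB)
  obtain ⟨i, him, hi, hi'⟩ := exists_measurable_resetSum T hB' hsyn'
    (f := B.indicator (1 : X → ℤ)) (measurable_one.indicator hB)
  have hfloor : Measurable fun x => ⌊D x / θ⌋ := Int.measurable_floor.comp (hDm.div_const θ)
  have hexc : Measurable fun x => ⌊(D x - θ * ⌊D x / θ⌋) / θ'⌋ := by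
    have : Measurable fun x => ((⌊D x / θ⌋ : ℤ) : ℝ) := measurable_from_top.comp hfloor
    exact Int.measurable_floor.comp ((hDm.sub (this.const_mul θ)).div_const θ')
  -- The number of small payments depends on the total excess of the block, known only at its end,
  -- so it is read off at the next visit to B'.
  obtain ⟨a, ham, ha, ha', haex⟩ := exists_measurable_nextValue T hB' hsyn' hexc
  have ha0 : ∀ x, 0 ≤ a x ∧ θ' * a x ≤ θ := by
    intro x
    obtain ⟨y, hy⟩ := haex x
    have hb := excess_bounds hθ (D y)
    rw [hy]
    refine ⟨Int.floor_nonneg.2 (div_nonneg hb.1 hθ'.le), ?_⟩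
    have := (excess_bounds hθ' (D y - θ * ⌊D y / θ⌋)).1
    linarith
  have hbasic : ∀ x, 1 ≤ i x ∧ 0 ≤ D x ∧ D x ≤ i x * (θ / 2) := by
    have key : ∀ p ∈ B', ∀ r, (∀ j, 0 < j → j ≤ r → (⇑T)^[j] p ∉ B') →
        1 ≤ i ((⇑T)^[r + 1] p) ∧ 0 ≤ D ((⇑T)^[r + 1] p) ∧
          D ((⇑T)^[r + 1] p) ≤ i ((⇑T)^[r + 1] p) * (θ / 2) := by
      intro p hp r
      induction r with
      | zero =>
        intro _
        have h1 := hi p hp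
        have h2 := hD p hp
        have hpB := hB'B hp
        have h3 := hδB p hpB
        simp only [indicator_of_mem hpB, Pi.one_apply] at h1 h2
        simp only [zero_add, Function.iterate_one, h1, h2]
        refine ⟨le_rfl, by linarith, by push_cast; linarith⟩
      | succ r ih =>
        intro h
        obtain ⟨g1, g2, g3⟩ := ih fun j h0 hj => h j h0 (by omega)
        have hn := h (r + 1) (by omega) le_rfl
        rw [Function.iterate_succ_apply', hi' _ hn, hD' _ hn]
        by_cases hxB : (⇑T)^[r + 1] p ∈ B
        · have h3 := hδB _ hxB
          simp only [indicator_of_mem hxB, Pi.one_apply]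
          refine ⟨by linarith, by linarith, by push_cast; linarith⟩
        · simp only [indicator_of_notMem hxB, add_zero]
          exact ⟨g1, g2, g3⟩
    intro x
    obtain ⟨r, p, hp, rfl, hr⟩ := exists_last_visit T hsyn' x
    exact key p hp r hr
  have hlong : ∀ x ∈ B', (K : ℤ) ≤ i x := by
    intro x hx
    obtain ⟨r, p, hp, rfl, hr⟩ := exists_last_visit T hsyn' x
    refine le_resetSum_indicator T hN hi hi' hp K r hr ?_
    have := hsepN p hp (r + 1) (by omega) hx
    rw [Nat.mul_succ] at this
    omega
  have hfl : ∀ x, 0 ≤ i x - 1 - ⌊D x / θ⌋ ∧ 2 * ⌊D x / θ⌋ ≤ i x := by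
    intro x
    obtain ⟨h1, h2, h3⟩ := hbasic x
    have h4 : D x / θ ≤ i x / 2 := by
      rw [div_le_iff₀ hθ]; linarith
    have h5 : (2 * ⌊D x / θ⌋ : ℝ) ≤ i x := by linarith [Int.floor_le (D x / θ)]
    have h6 : 2 * ⌊D x / θ⌋ ≤ i x := by exact_mod_cast h5
    omega
  refine ⟨fun x => displacement θ θ' (D x) (i x) (a x), ?_, ?_, ?_, ?_, ?_⟩
  · have h1 : Measurable fun x => ((⌊D x / θ⌋ : ℤ) : ℝ) := measurable_from_top.comp hfloor
    have h2 : Measurable fun x => ((min (i x - 1 - ⌊D x / θ⌋) (a x) : ℤ) : ℝ) :=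
      measurable_from_top.comp (((him.sub_const 1).sub hfloor).min ham)
    exact (hDm.neg.add (h1.const_mul θ)).add (h2.const_mul θ')
  · intro x
    have h1 := excess_bounds hθ (D x)
    obtain ⟨h2, h3⟩ := ha0 x
    have h4 : (0 : ℝ) ≤ (min (i x - 1 - ⌊D x / θ⌋) (a x) : ℤ) := by
      exact_mod_cast le_min (hfl x).1 h2
    have h5 : ((min (i x - 1 - ⌊D x / θ⌋) (a x) : ℤ) : ℝ) ≤ a x := by
      exact_mod_cast min_le_right _ _
    have h6 := mul_nonneg hθ'.le h4
    have h7 := mul_le_mul_of_nonneg_left h5 hθ'.le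
    rw [abs_le]
    simp only [displacement]
    constructor <;> linarith
  · intro x hx
    have hxB' : x ∉ B' := fun h => hx (hB'B h)
    simp only [hD' x hxB', hi' x hxB', ha' x hxB', indicator_of_notMem hx, add_zero]
  · intro x hx
    have hxB := hB'B hx
    have hδx := hδB x hxB
    have h1 : displacement θ θ' (D (T x)) (i (T x)) (a (T x)) = -(δ x - τ) := by
      have hfl0 : ⌊(δ x - τ) / θ⌋ = 0 := by
        rw [Int.floor_eq_zero_iff]
        refine ⟨div_nonneg (by linarith) hθ.le, ?_⟩
        rw [div_lt_one hθ]
        linarith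
      rw [hD x hx, hi x hx, indicator_of_mem hxB, indicator_of_mem hxB]
      simp [displacement, hfl0, (ha0 (T x)).1]
    -- At the end of a block all a payments have been made, so −h(x) is the residue modulo θ'.
    have h2 : min (i x - 1 - ⌊D x / θ⌋) (a x) = a x := by
      refine min_eq_right ?_
      have hb : (a x : ℝ) ≤ θ / θ' := by
        rw [le_div_iff₀ hθ']
        linarith [(ha0 x).2]
      have hc : ((2 * a x + 2 : ℤ) : ℝ) ≤ (K : ℤ) := by
        push_cast
        linarith
      have hd : 2 * a x + 2 ≤ (K : ℤ) := by exact_mod_cast hc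
      have he := hlong x hx
      have hg := (hfl x).2
      omega
    have h3 := excess_bounds hθ' (D x - θ * ⌊D x / θ⌋)
    have h4 : displacement θ θ' (D x) (i x) (a x) =
        -(D x - θ * ⌊D x / θ⌋ - θ' * ⌊(D x - θ * ⌊D x / θ⌋) / θ'⌋) := by
      rw [displacement, h2, ha x hx]
      ring
    simp only [h1, h4]
    constructor <;> linarith
  · intro x hxB hx
    have hδx := hδB x hxB
    have hs := displacement_step θ' hθ (D := D x) (d := δ x - τ) (by linarith) (by linarith)
      (i x) (a x)
    simp only [hD' x hx, hi' x hx, ha' x hx, indicator_of_mem hxB, Pi.one_apply]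
    rcases hs with h | h | h
    · left; linarith
    · right; left; linarith
    · right; right; linarith

end BorelFlow

/-! ### Iterating the correction and summing the displacements -/

namespace BorelFlow

variable {X : Type*} [MeasurableSpace X]

/-- The lengths `δ` lie in the range of `s` off the sparse set `B`, and between `s (n + 2)` and
`s (n + 1)` on `B`. -/
structure IsApproximation (T : X ≃ᵐ X) (s : ℕ → ℝ) (n : ℕ) (p : Set X × (X → ℝ)) : Prop where
  measurableSet : MeasurableSet p.1
  measurable : Measurable p.2
  syndetic : IsSyndetic T p.1
  sparse : ∀ x ∈ p.1, ∀ j : ℕ, 0 < j → (⇑T)^[j] x ∈ p.1 → n ≤ j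
  bounds : ∀ x ∈ p.1, s (n + 2) ≤ p.2 x ∧ p.2 x ≤ s (n + 1)
  mem_range : ∀ x ∉ p.1, p.2 x ∈ range s

/-- `q` arises from `p` by a displacement `h` that is bounded by `c` and rigid off `p.1`. -/
structure IsRefinement (T : X ≃ᵐ X) (c : ℝ) (p q : Set X × (X → ℝ)) (h : X → ℝ) : Prop where
  subset : q.1 ⊆ p.1
  measurable : Measurable h
  abs_le : ∀ x, |h x| ≤ c
  rigid : ∀ x ∉ p.1, h (T x) = h x
  eq : ∀ x, q.2 x = p.2 x + h (T x) - h x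

/-- The parameters make τ, τ + θ, τ + θ' equal to s(n+3), s(n), s(n+2). Fourfold decay gives s(n+1)
≤ τ + θ/2. -/
theorem IsApproximation.exists_refinement [StandardBorelSpace X] {T : X ≃ᵐ X}
    (haper : ∀ x, ∀ n : ℕ, 0 < n → (⇑T)^[n] x ≠ x) {s : ℕ → ℝ} (hs : ∀ n, 0 < s n)
    (hs4 : ∀ n, s (n + 1) ≤ s n / 4) {n : ℕ} {p : Set X × (X → ℝ)}
    (hp : IsApproximation T s n p) :
    ∃ q, IsApproximation T s (n + 1) q ∧ ∃ h, IsRefinement T (s n) p q h := by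
  have e1 := hs4 n
  have e2 := hs4 (n + 1)
  have e3 := hs4 (n + 2)
  have p3 := hs (n + 3)
  simp only [add_assoc, Nat.reduceAdd] at e1 e2 e3
  obtain ⟨B', hB'B, hB', hsyn', hsep, h, hm, hle, hrig, hon, hoff⟩ :=
    exists_displacement T haper hp.measurableSet hp.syndetic hp.measurable
      (θ := s n - s (n + 3)) (θ' := s (n + 2) - s (n + 3)) (τ := s (n + 3))
      (by linarith) (by linarith)
      (fun x hx => ⟨by linarith [(hp.bounds x hx).1], by linarith [(hp.bounds x hx).2]⟩) (n + 1)
  refine ⟨⟨B', fun x => p.2 x + h (T x) - h x⟩,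
    ⟨hB', (hp.measurable.add (hm.comp T.measurable)).sub hm, hsyn',
      fun x hx j hj hjx => (hsep x hx j hj hjx).le, ?_, ?_⟩,
    h, hB'B, hm, fun x => (hle x).trans (by linarith), hrig, fun x => rfl⟩
  · intro x hx
    obtain ⟨h1, h2⟩ := hon x hx
    exact ⟨h1, by linarith⟩
  · intro x hx
    by_cases hxB : x ∈ p.1
    · rcases hoff x hxB hx with h | h | h
      · exact ⟨n + 3, h.symm⟩
      · exact ⟨n, by simp only [h]; ring⟩
      · exact ⟨n + 2, by simp only [h]; ring⟩
    · simp only [hrig x hxB, add_sub_cancel_right]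
      exact hp.mem_range x hxB

/-- A sequence of refinements starting from the lengths `δ`. -/
theorem exists_refinements [StandardBorelSpace X] (T : X ≃ᵐ X)
    (haper : ∀ x, ∀ n : ℕ, 0 < n → (⇑T)^[n] x ≠ x) {s : ℕ → ℝ} (hs : ∀ n, 0 < s n)
    (hs4 : ∀ n, s (n + 1) ≤ s n / 4) {δ : X → ℝ} (hδ : Measurable δ)
    (hδs : ∀ x, s 2 ≤ δ x ∧ δ x ≤ s 1) :
    ∃ (p : ℕ → Set X × (X → ℝ)) (h : ℕ → X → ℝ), (p 0).2 = δ ∧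
      (∀ n, IsApproximation T s n (p n)) ∧ ∀ n, IsRefinement T (s n) (p n) (p (n + 1)) (h n) := by
  have h0 : IsApproximation T s 0 (univ, δ) :=
    ⟨MeasurableSet.univ, hδ, ⟨1, fun x => ⟨0, one_pos, mem_univ _⟩⟩, fun _ _ _ _ _ => Nat.zero_le _,
      fun x _ => hδs x, fun x hx => absurd (mem_univ x) hx⟩
  choose next hnext hrel using fun (n : ℕ) (p : {p // IsApproximation T s n p}) =>
    p.2.exists_refinement haper hs hs4
  let q : ∀ n, {p // IsApproximation T s n p} := fun n =>
    Nat.rec ⟨_, h0⟩ (fun n p => ⟨next n p, hnext n p⟩) n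
  choose h hh using fun n => hrel n (q n)
  exact ⟨fun n => (q n).1, h, rfl, fun n => (q n).2, hh⟩

/-- A bounded displacement that makes arbitrarily long runs of lengths lie in the range of `s`. -/
theorem exists_coboundary [StandardBorelSpace X] (T : X ≃ᵐ X)
    (haper : ∀ x, ∀ n : ℕ, 0 < n → (⇑T)^[n] x ≠ x) {s : ℕ → ℝ} (hs : ∀ n, 0 < s n)
    (hs4 : ∀ n, s (n + 1) ≤ s n / 4) {δ : X → ℝ} (hδ : Measurable δ)
    (hδs : ∀ x, s 2 ≤ δ x ∧ δ x ≤ s 1) :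
    ∃ H : X → ℝ, Measurable H ∧ (∀ x, |H x| ≤ 2 * s 0) ∧ ∀ (x : X) (n : ℕ), ∃ m : ℕ, ∀ j < n,
      δ ((⇑T)^[j + m] x) + H (T ((⇑T)^[j + m] x)) - H ((⇑T)^[j + m] x) ∈ range s := by
  obtain ⟨p, h, hp0, hp, hh⟩ := exists_refinements T haper hs hs4 hδ hδs
  have hgeo : ∀ n, s n ≤ s 0 * (1 / 2) ^ n := by
    intro n
    induction n with
    | zero => simp
    | succ n ih => rw [pow_succ]; linarith [hs4 n, hs n]
  have hbound : ∀ x n, ‖h n x‖ ≤ s 0 * (1 / 2) ^ n := fun x n =>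
    ((hh n).abs_le x).trans (hgeo n)
  have hgs : HasSum (fun n : ℕ => s 0 * (1 / 2 : ℝ) ^ n) (s 0 * 2) :=
    hasSum_geometric_two.mul_left (s 0)
  have hsum : ∀ x, Summable fun n => h n x := fun x =>
    Summable.of_norm_bounded hgs.summable (hbound x)
  have hlim : ∀ x, Tendsto (fun n => ∑ k ∈ Finset.range n, h k x) atTop (𝓝 (∑' k, h k x)) :=
    fun x => (hsum x).hasSum.tendsto_sum_nat
  refine ⟨fun x => ∑' n, h n x, ?_, ?_, ?_⟩
  · exact measurable_of_tendsto_metrizable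
      (fun n => Finset.measurable_fun_sum (Finset.range n) fun k _ => (hh k).measurable)
      (tendsto_pi_nhds.2 hlim)
  · intro x
    rw [mul_comm]
    exact tsum_of_norm_bounded hgs (hbound x)
  · intro x n
    have hpn : ∀ k x, (p k).2 x =
        δ x + ∑ i ∈ Finset.range k, h i (T x) - ∑ i ∈ Finset.range k, h i x := by
      intro k x
      induction k with
      | zero => simp [hp0]
      | succ k ih =>
        rw [(hh k).eq, ih, Finset.sum_range_succ, Finset.sum_range_succ]
        ring
    have hanti : ∀ k, (p (n + 1 + k)).1 ⊆ (p (n + 1)).1 := by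
      intro k
      induction k with
      | zero => rfl
      | succ k ih => exact ((hh (n + 1 + k)).subset).trans ih
    -- Off this set all later displacements are rigid, so the partial lengths are eventually
    -- constant and their limit is a value of `s`.
    have hstable : ∀ y ∉ (p (n + 1)).1, δ y + ∑' i, h i (T y) - ∑' i, h i y ∈ range s := by
      intro y hy
      have hconst : ∀ k, (p (n + 1 + k)).2 y = (p (n + 1)).2 y := by
        intro k
        induction k with
        | zero => rfl
        | succ k ih =>
          rw [← ih, ← add_assoc, (hh (n + 1 + k)).eq,
            (hh (n + 1 + k)).rigid y fun h => hy (hanti k h), add_sub_cancel_right]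
      have h1 : Tendsto (fun k => (p k).2 y) atTop
          (𝓝 (δ y + ∑' i, h i (T y) - ∑' i, h i y)) := by
        simp only [hpn]
        exact ((hlim (T y)).const_add (δ y)).sub (hlim y)
      have h2 : Tendsto (fun k => (p k).2 y) atTop (𝓝 ((p (n + 1)).2 y)) := by
        refine tendsto_atTop_of_eventually_const (i₀ := n + 1) fun k hk => ?_
        obtain ⟨l, rfl⟩ := Nat.exists_eq_add_of_le hk
        exact hconst l
      rw [tendsto_nhds_unique h1 h2]
      exact (hp (n + 1)).mem_range y hy
    obtain ⟨N, hN⟩ := (hp (n + 1)).syndetic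
    obtain ⟨m, -, hm⟩ := hN x
    -- The run starts one step after a visit; the next visit is at least n + 1 steps after that
    -- visit.
    refine ⟨m + 1, fun j hj => hstable _ fun hmem => ?_⟩
    rw [show j + (m + 1) = (j + 1) + m by ring, Function.iterate_add_apply] at hmem
    have := (hp (n + 1)).sparse _ hm (j + 1) (by omega) hmem
    omega

end BorelFlow

/-! ### Lacunary Borel sets -/

namespace BorelFlow

section Lacunary

variable {Ω : Type*} [AddAction ℝ Ω]

/-- Distinct points of `A` on an orbit are at least `c` apart. -/
def IsLacunary (c : ℝ) (A : Set Ω) : Prop :=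
  ∀ x ∈ A, ∀ r : ℝ, 0 < r → r +ᵥ x ∈ A → c ≤ r

theorem IsLacunary.mono {c : ℝ} {A B : Set Ω} (hA : IsLacunary c A) (h : B ⊆ A) :
    IsLacunary c B := fun x hx r hr hrx => hA x (h hx) r hr (h hrx)

theorem IsLacunary.le_abs {c : ℝ} {A : Set Ω} (hA : IsLacunary c A) {x : Ω} (hx : x ∈ A) {r : ℝ}
    (hr : r ≠ 0) (hrx : r +ᵥ x ∈ A) : c ≤ |r| := by
  rcases lt_or_gt_of_ne hr with h | h
  · rw [abs_of_neg h]
    refine hA _ hrx (-r) (by linarith) ?_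
    rwa [vadd_vadd, neg_add_cancel, zero_vadd]
  · rw [abs_of_pos h]
    exact hA x hx r h hrx

theorem IsLacunary.finite_returns {c : ℝ} (hc : 0 < c) {A : Set Ω} (hA : IsLacunary c A) (x : Ω)
    (L : ℝ) : {r : ℝ | |r| ≤ L ∧ r +ᵥ x ∈ A}.Finite := by
  refine Finite.of_finite_image (f := fun r : ℝ => ⌊r / c⌋)
    ((Finset.Icc ⌊-L / c⌋ ⌊L / c⌋).finite_toSet.subset ?_) ?_
  · rintro _ ⟨r, ⟨hL, -⟩, rfl⟩
    rw [abs_le] at hL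
    simp only [Finset.coe_Icc, mem_Icc]
    exact ⟨Int.floor_le_floor (by gcongr; exact hL.1), Int.floor_le_floor (by gcongr; exact hL.2)⟩
  · intro r hr r' hr' h
    by_contra hne
    have h1 := Int.abs_sub_lt_one_of_floor_eq_floor h
    rw [← sub_div, abs_div, abs_of_pos hc, div_lt_one hc] at h1
    refine absurd (hA.le_abs hr'.2 (sub_ne_zero.2 hne) ?_) (not_le.2 h1)
    rw [vadd_vadd, sub_add_cancel]
    exact hr.2

variable [MeasurableSpace Ω] [StandardBorelSpace Ω] [MeasurableVAdd₂ ℝ Ω]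

/-- On times within one cell of length c the map (r, x) ↦ r + x is injective by lacunarity, so
Lusin–Souslin applies cell by cell. -/
theorem IsLacunary.measurableSet_thicken {c : ℝ} (hc : 0 < c) {A : Set Ω}
    (hA : IsLacunary c A) (hAm : MeasurableSet A) {I : Set ℝ} (hI : MeasurableSet I) :
    MeasurableSet {y : Ω | ∃ r ∈ I, ∃ x ∈ A, r +ᵥ x = y} := by
  have : {y : Ω | ∃ r ∈ I, ∃ x ∈ A, r +ᵥ x = y} =
      ⋃ j : ℤ, (fun p : ℝ × Ω => p.1 +ᵥ p.2) '' ((I ∩ {r | ⌊r / c⌋ = j}) ×ˢ A) := by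
    ext y
    simp only [mem_ofPred_eq, mem_iUnion, mem_image, mem_prod, mem_inter_iff, Prod.exists]
    constructor
    · rintro ⟨r, hr, x, hx, rfl⟩
      exact ⟨⌊r / c⌋, r, x, ⟨⟨hr, rfl⟩, hx⟩, rfl⟩
    · rintro ⟨j, r, x, ⟨⟨hr, -⟩, hx⟩, rfl⟩
      exact ⟨r, hr, x, hx, rfl⟩
  rw [this]
  refine MeasurableSet.iUnion fun j => MeasurableSet.image_of_measurable_injOn ?_ ?_ ?_
  · have h1 : Measurable fun r : ℝ => ⌊r / c⌋ := Int.measurable_floor.comp (measurable_id.div_const c)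
    exact (hI.inter (h1 (measurableSet_singleton j))).prod hAm
  · exact measurable_fst.vadd measurable_snd
  · rintro ⟨r, x⟩ ⟨⟨-, hr⟩, hx⟩ ⟨r', x'⟩ ⟨⟨-, hr'⟩, hx'⟩ h
    simp only [mem_ofPred_eq] at hr hr' hx hx' h
    have h1 : (r - r') +ᵥ x = x' := by
      rw [sub_eq_neg_add, ← vadd_vadd, h, vadd_vadd, neg_add_cancel, zero_vadd]
    have h2 : r = r' := by
      by_contra hne
      have h3 := Int.abs_sub_lt_one_of_floor_eq_floor (hr.trans hr'.symm)
      rw [← sub_div, abs_div, abs_of_pos hc, div_lt_one hc] at h3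
      exact absurd (hA.le_abs hx (sub_ne_zero.2 hne) (h1 ▸ hx')) (not_le.2 h3)
    subst h2
    rw [sub_self, zero_vadd] at h1
    rw [h1]

/-- A Borel lacunary set is a countable union of Borel sets with any given lacunarity constant. -/
theorem IsLacunary.exists_cover (hfree : IsFree Ω) {c : ℝ} (hc : 0 < c) {A : Set Ω}
    (hA : IsLacunary c A) (hAm : MeasurableSet A) (L : ℝ) :
    ∃ V : ℕ → Set Ω, (∀ n, MeasurableSet (V n)) ∧ (∀ n, IsLacunary L (V n)) ∧ A ⊆ ⋃ n, V n := by
  obtain ⟨U, hU, hsep⟩ := exists_separating_sets Ω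
  -- A point is discarded if another point of `A ∩ U n` follows within time L; finiteness of returns
  -- lets some `U n` exclude all followers of a given point.
  refine ⟨fun n => (A ∩ U n) \ {y | ∃ r ∈ Ico (-L) 0, ∃ x ∈ A ∩ U n, r +ᵥ x = y},
    fun n => (hAm.inter (hU n)).diff ((hA.mono inter_subset_left).measurableSet_thicken hc
      (hAm.inter (hU n)) measurableSet_Ico), ?_, ?_⟩
  · rintro n x hx r hr hrx
    by_contra h
    exact hx.2 ⟨-r, ⟨by linarith, by linarith⟩, r +ᵥ x, hrx.1,
      by rw [vadd_vadd, neg_add_cancel, zero_vadd]⟩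
  · intro x hx
    obtain ⟨n, hn, hnF⟩ := hsep x _ (((hA.finite_returns hc x L).inter_of_right (Ioi 0)).image
      (fun r => r +ᵥ x)) (by
        rintro ⟨r, ⟨hr, -⟩, h⟩
        exact (mem_Ioi.1 hr).ne' (hfree r x h))
    refine mem_iUnion.2 ⟨n, ⟨hx, hn⟩, ?_⟩
    rintro ⟨r, ⟨hr1, hr2⟩, y, ⟨hyA, hyU⟩, rfl⟩
    have : -r +ᵥ (r +ᵥ y) = y := by rw [vadd_vadd, neg_add_cancel, zero_vadd]
    exact hnF y ⟨-r, ⟨mem_Ioi.2 (by linarith), by rw [abs_of_pos] <;> linarith, by rwa [this]⟩, this⟩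
      hyU

end Lacunary

/-! ### Level crossings of functions continuous along orbits -/

section Crossing

variable {Ω : Type*} [AddAction ℝ Ω]

/-- The points where `F` is at least `c`, to be smaller than `c` for the time `q`. -/
def exitSet (F : Ω → ℝ) (c q : ℝ) : Set Ω :=
  {y | c ≤ F y ∧ ∀ ρ ∈ Ioo 0 q, F (ρ +ᵥ y) < c}

theorem isLacunary_exitSet (F : Ω → ℝ) (c q : ℝ) : IsLacunary q (exitSet F c q) := by
  intro x hx r hr hrx
  by_contra h
  exact absurd hrx.1 (not_le.2 (hx.2 r ⟨hr, by linarith⟩))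

theorem exists_mem_exitSet {F : Ω → ℝ} {ω : Ω} (hcont : Continuous fun r : ℝ => F (r +ᵥ ω))
    {c s₁ s₂ : ℝ} (hs : s₁ < s₂) (h₁ : c ≤ F (s₁ +ᵥ ω)) (h₂ : F (s₂ +ᵥ ω) < c) :
    ∃ (n : ℕ) (s : ℝ), s +ᵥ ω ∈ exitSet F c (1 / ((n : ℝ) + 1)) := by
  let E : Set ℝ := Icc s₁ s₂ ∩ {r | c ≤ F (r +ᵥ ω)}
  have hE : IsCompact E := isCompact_Icc.inter_right (isClosed_le continuous_const hcont)
  -- The last time before s₂ at which F is at least c is an exit time.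
  obtain ⟨z, hz⟩ := hE.exists_isGreatest ⟨s₁, ⟨le_rfl, hs.le⟩, h₁⟩
  have hz2 : z < s₂ := lt_of_le_of_ne hz.1.1.2 (by
    rintro rfl
    exact absurd hz.1.2 (not_le.2 h₂))
  obtain ⟨n, hn⟩ := exists_nat_one_div_lt (sub_pos.2 hz2)
  refine ⟨n, z, hz.1.2, fun ρ hρ => ?_⟩
  by_contra h
  rw [not_lt, vadd_vadd] at h
  have := hz.2 ⟨⟨by linarith [hz.1.1.1, hρ.1], by linarith [hρ.2]⟩, h⟩
  linarith [hρ.1]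

variable [MeasurableSpace Ω] [MeasurableVAdd₂ ℝ Ω]

theorem measurableSet_forall_Ioo_le {F : Ω → ℝ} (hF : Measurable F)
    (hcont : ∀ ω, Continuous fun r : ℝ => F (r +ᵥ ω)) (a b d : ℝ) :
    MeasurableSet {y | ∀ ρ ∈ Ioo a b, F (ρ +ᵥ y) ≤ d} := by
  have : {y | ∀ ρ ∈ Ioo a b, F (ρ +ᵥ y) ≤ d} =
      ⋂ (u : ℚ) (_ : (u : ℝ) ∈ Ioo a b), {y | F ((u : ℝ) +ᵥ y) ≤ d} := by
    ext y
    simp only [mem_ofPred_eq, mem_iInter]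
    refine ⟨fun h u hu => h u hu, fun h ρ hρ => ?_⟩
    have h1 : ρ ∈ closure (Ioo a b ∩ range ((↑) : ℚ → ℝ)) :=
      (Rat.denseRange_cast (𝕜 := ℝ)).open_subset_closure_inter isOpen_Ioo hρ
    have h2 : IsClosed {r : ℝ | F (r +ᵥ y) ≤ d} := isClosed_le (hcont y) continuous_const
    refine closure_minimal ?_ h2 h1
    rintro _ ⟨hu, u, rfl⟩
    exact h u hu
  rw [this]
  exact MeasurableSet.iInter fun u => MeasurableSet.iInter fun _ =>
    measurableSet_le (hF.comp (measurable_const_vadd (u : ℝ))) measurable_const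

/-- Compactness turns F < c on an open interval into a uniform margin on each closed subinterval,
and non-strict bounds need only be checked at rational times. -/
theorem measurableSet_exitSet {F : Ω → ℝ} (hF : Measurable F)
    (hcont : ∀ ω, Continuous fun r : ℝ => F (r +ᵥ ω)) (c q : ℝ) :
    MeasurableSet (exitSet F c q) := by
  have : exitSet F c q = {y | c ≤ F y} ∩ ⋂ n : ℕ, ⋃ m : ℕ,
      {y | ∀ ρ ∈ Ioo (0 + 1 / ((n : ℝ) + 1)) (q - 1 / ((n : ℝ) + 1)),
        F (ρ +ᵥ y) ≤ c - 1 / ((m : ℝ) + 1)} := by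
    ext y
    simp only [exitSet, mem_ofPred_eq, mem_inter_iff, mem_iInter, mem_iUnion]
    refine and_congr_right fun _ => ⟨fun h n => ?_, fun h ρ hρ => ?_⟩
    · rcases (Icc (0 + 1 / ((n : ℝ) + 1)) (q - 1 / ((n : ℝ) + 1))).eq_empty_or_nonempty with he | hne
      · exact ⟨0, fun ρ hρ => absurd (Ioo_subset_Icc_self hρ) (he ▸ notMem_empty ρ)⟩
      · obtain ⟨z, hz, hmax⟩ := isCompact_Icc.exists_isMaxOn hne (hcont y).continuousOn
        have hp : 0 < 1 / ((n : ℝ) + 1) := Nat.one_div_pos_of_nat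
        have hz' := h z ⟨by linarith [hz.1], by linarith [hz.2]⟩
        obtain ⟨m, hm⟩ := exists_nat_one_div_lt (sub_pos.2 hz')
        refine ⟨m, fun ρ hρ => ?_⟩
        have := hmax (Ioo_subset_Icc_self hρ)
        simp only [mem_ofPred_eq] at this
        linarith
    · obtain ⟨n, hn⟩ := exists_nat_one_div_lt (lt_min hρ.1 (sub_pos.2 hρ.2))
      have h1 := hn.trans_le (min_le_left _ _)
      have h2 := hn.trans_le (min_le_right _ _)
      obtain ⟨m, hm⟩ := h n
      have h3 := hm ρ ⟨by linarith, by linarith⟩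
      have hp : 0 < 1 / ((m : ℝ) + 1) := Nat.one_div_pos_of_nat
      linarith
  rw [this]
  exact (measurableSet_le measurable_const hF).inter (MeasurableSet.iInter fun n =>
    MeasurableSet.iUnion fun m => measurableSet_forall_Ioo_le hF hcont _ _ _)

end Crossing

end BorelFlow

/-! ### Occupation times and existence of syndetic lacunary sets -/

namespace BorelFlow

/-- The time that `ω` spends in `U` up to time `w`. -/
noncomputable def occupation {Ω : Type*} [AddAction ℝ Ω] (U : Set Ω) (w : ℝ) (ω : Ω) : ℝ :=
  ∫ r in (0 : ℝ)..w, U.indicator (1 : Ω → ℝ) (r +ᵥ ω)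

section Occupation

open MeasureTheory

variable {Ω : Type*} [AddAction ℝ Ω] [MeasurableSpace Ω] [MeasurableVAdd₂ ℝ Ω] {U : Set Ω}

theorem measurable_occupation (hU : MeasurableSet U) (w : ℝ) : Measurable (occupation U w) := by
  have h : StronglyMeasurable
      (Function.uncurry fun (ω : Ω) (r : ℝ) => U.indicator (1 : Ω → ℝ) (r +ᵥ ω)) :=
    ((measurable_one.indicator hU).comp
      (measurable_snd.vadd measurable_fst)).stronglyMeasurable
  unfold occupation intervalIntegral
  exact (h.integral_prod_right (ν := volume.restrict (Ioc 0 w))).measurable.sub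
    (h.integral_prod_right (ν := volume.restrict (Ioc w 0))).measurable

theorem locallyIntegrable_indicator_orbit (hU : MeasurableSet U) (ω : Ω) :
    LocallyIntegrable (fun r : ℝ => U.indicator (1 : Ω → ℝ) (r +ᵥ ω)) := by
  have hm : Measurable fun r : ℝ => U.indicator (1 : Ω → ℝ) (r +ᵥ ω) :=
    (measurable_one.indicator hU).comp (measurable_id.vadd measurable_const)
  refine (locallyIntegrable_const (1 : ℝ)).mono hm.aestronglyMeasurable
    (Eventually.of_forall fun r => ?_)
  by_cases h : r +ᵥ ω ∈ U <;> simp [h]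

theorem intervalIntegrable_indicator_orbit (hU : MeasurableSet U) (ω : Ω) (a b : ℝ) :
    IntervalIntegrable (fun r : ℝ => U.indicator (1 : Ω → ℝ) (r +ᵥ ω)) volume a b :=
  intervalIntegrable_iff.2 (((locallyIntegrable_indicator_orbit hU ω).integrableOn_isCompact
    isCompact_uIcc).mono_set uIoc_subset_uIcc)

theorem occupation_vadd (hU : MeasurableSet U) (w s : ℝ) (ω : Ω) :
    occupation U w (s +ᵥ ω) = (∫ r in (0 : ℝ)..(s + w), U.indicator (1 : Ω → ℝ) (r +ᵥ ω)) -
      ∫ r in (0 : ℝ)..s, U.indicator (1 : Ω → ℝ) (r +ᵥ ω) := by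
  have hi := intervalIntegrable_indicator_orbit hU ω
  rw [intervalIntegral.integral_interval_sub_left (hi _ _) (hi _ _), occupation]
  simp only [vadd_vadd]
  rw [intervalIntegral.integral_comp_add_right
    (fun r : ℝ => U.indicator (1 : Ω → ℝ) (r +ᵥ ω)) s, zero_add, add_comm]

theorem continuous_occupation (hU : MeasurableSet U) (w : ℝ) (ω : Ω) :
    Continuous fun s : ℝ => occupation U w (s +ᵥ ω) := by
  have h : Continuous fun x : ℝ => ∫ r in (0 : ℝ)..x, U.indicator (1 : Ω → ℝ) (r +ᵥ ω) :=
    intervalIntegral.continuous_primitive (intervalIntegrable_indicator_orbit hU ω) 0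
  simp only [occupation_vadd hU]
  exact (h.comp (continuous_add_const w)).sub h

theorem ae_tendsto_occupation (hU : MeasurableSet U) (ω : Ω) :
    ∀ᵐ s : ℝ, Tendsto
      (fun m : ℕ => (1 / ((m : ℝ) + 1))⁻¹ • occupation U (1 / ((m : ℝ) + 1)) (s +ᵥ ω))
      atTop (𝓝 (U.indicator 1 (s +ᵥ ω))) := by
  filter_upwards [_root_.LocallyIntegrable.ae_hasDerivAt_integral
    (locallyIntegrable_indicator_orbit hU ω)] with s hs
  have h1 := (hs 0).tendsto_slope_zero_right
  have h2 : Tendsto (fun m : ℕ => 1 / ((m : ℝ) + 1)) atTop (𝓝[>] 0) :=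
    tendsto_nhdsWithin_iff.2 ⟨tendsto_one_div_add_atTop_nhds_zero_nat,
      Eventually.of_forall fun m => mem_Ioi.2 Nat.one_div_pos_of_nat⟩
  simp only [occupation_vadd hU]
  exact h1.comp h2

/-- On each orbit of a free flow, one of countably many occupation times is not constant. -/
theorem exists_occupation_ne (hfree : IsFree Ω) {U : ℕ → Set Ω} (hU : ∀ n, MeasurableSet (U n))
    (hsep : ∀ x y, x ≠ y → ∃ n, x ∈ U n ∧ y ∉ U n) (ω : Ω) :
    ∃ (n m : ℕ) (s : ℝ), occupation (U n) (1 / ((m : ℝ) + 1)) (s +ᵥ ω) ≠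
      occupation (U n) (1 / ((m : ℝ) + 1)) ω := by
  by_contra! hconst
  -- By Lebesgue differentiation, constant occupation times make every indicator almost everywhere
  -- constant along the orbit, so two distinct generic points could not be separated.
  have hae : ∀ᵐ s : ℝ, ∀ n,
      Tendsto (fun m : ℕ => (1 / ((m : ℝ) + 1))⁻¹ • occupation (U n) (1 / ((m : ℝ) + 1)) ω)
        atTop (𝓝 ((U n).indicator 1 (s +ᵥ ω))) := by
    rw [ae_all_iff]
    intro n
    filter_upwards [ae_tendsto_occupation (hU n) ω] with s hs
    simpa only [hconst] using hs
  obtain ⟨s₀, h₀⟩ := hae.exists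
  have hne : ∀ᵐ s : ℝ, s ≠ s₀ := by simp [ae_iff, measure_singleton]
  obtain ⟨s₁, h₁, h₁₀⟩ := (hae.and hne).exists
  obtain ⟨n, hn₁, hn₀⟩ := hsep (s₁ +ᵥ ω) (s₀ +ᵥ ω) (fun h => h₁₀ (by
    have : (s₁ - s₀) +ᵥ (s₀ +ᵥ ω) = s₀ +ᵥ ω := by rw [vadd_vadd, sub_add_cancel, h]
    linarith [hfree _ _ this]))
  have := tendsto_nhds_unique (h₀ n) (h₁ n)
  simp [hn₀, hn₁] at this

end Occupation

variable {Ω : Type*} [AddAction ℝ Ω] [MeasurableSpace Ω] [StandardBorelSpace Ω]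
  [MeasurableVAdd₂ ℝ Ω]

/-- A nonconstant occupation time crosses a rational level. The Boolean is a sign, turning an upward
crossing into an exit. -/
theorem exists_lacunary_family (hfree : IsFree Ω) (L : ℝ) :
    ∃ V : ((ℕ × ℕ × Bool × ℚ × ℕ) × ℕ) → Set Ω, (∀ i, MeasurableSet (V i)) ∧
      (∀ i, IsLacunary L (V i)) ∧ ∀ ω, ∃ i, ∃ s : ℝ, s +ᵥ ω ∈ V i := by
  obtain ⟨U, hU, hsep⟩ := exists_separating_sets Ω
  let F : ℕ → ℕ → Bool → Ω → ℝ := fun n m b ω =>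
    (if b then 1 else -1) * occupation (U n) (1 / ((m : ℝ) + 1)) ω
  have hF : ∀ n m b, Measurable (F n m b) := fun n m b =>
    (measurable_occupation (hU n) _).const_mul _
  have hFc : ∀ n m b ω, Continuous fun r : ℝ => F n m b (r +ᵥ ω) := fun n m b ω =>
    (continuous_occupation (hU n) _ ω).const_mul _
  choose V hV hVL hVc using fun i : ℕ × ℕ × Bool × ℚ × ℕ =>
    (isLacunary_exitSet (F i.1 i.2.1 i.2.2.1) i.2.2.2.1 (1 / ((i.2.2.2.2 : ℝ) + 1))).exists_cover
      hfree Nat.one_div_pos_of_nat (measurableSet_exitSet (hF _ _ _) (hFc _ _ _) _ _) L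
  refine ⟨fun i => V i.1 i.2, fun i => hV i.1 i.2, fun i => hVL i.1 i.2, fun ω => ?_⟩
  have key : ∀ n m b (s₁ s₂ : ℝ), s₁ < s₂ → F n m b (s₂ +ᵥ ω) < F n m b (s₁ +ᵥ ω) →
      ∃ i, ∃ s : ℝ, s +ᵥ ω ∈ V (i : (ℕ × ℕ × Bool × ℚ × ℕ) × ℕ).1 i.2 := by
    intro n m b s₁ s₂ hs hlt
    obtain ⟨c, hc₂, hc₁⟩ := exists_rat_btwn hlt
    obtain ⟨k, s, hk⟩ := exists_mem_exitSet (hFc n m b ω) hs hc₁.le hc₂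
    obtain ⟨j, hj⟩ := mem_iUnion.1 (hVc (n, m, b, c, k) hk)
    exact ⟨((n, m, b, c, k), j), s, hj⟩
  obtain ⟨n, m, s, hne⟩ := exists_occupation_ne hfree hU (fun x y hxy => by
    obtain ⟨n, hn, hn'⟩ := hsep x {y} (finite_singleton y) hxy
    exact ⟨n, hn, hn' y rfl⟩) ω
  have hs : s ≠ 0 := by
    rintro rfl
    exact hne (by rw [zero_vadd])
  have key' : ∀ s₁ s₂ : ℝ, s₁ < s₂ → occupation (U n) (1 / ((m : ℝ) + 1)) (s₁ +ᵥ ω) ≠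
      occupation (U n) (1 / ((m : ℝ) + 1)) (s₂ +ᵥ ω) →
      ∃ i, ∃ s : ℝ, s +ᵥ ω ∈ V (i : (ℕ × ℕ × Bool × ℚ × ℕ) × ℕ).1 i.2 := by
    intro s₁ s₂ h12 h
    rcases lt_or_gt_of_ne h with h | h
    · exact key n m false s₁ s₂ h12 (by simpa [F] using h)
    · exact key n m true s₁ s₂ h12 (by simpa [F] using h)
  rcases lt_or_gt_of_ne hs with h | h
  · exact key' s 0 h (by rwa [zero_vadd])
  · exact key' 0 s h (by rw [zero_vadd]; exact hne.symm)

/-- Existence of Borel cross sections with bounded gaps and any lacunarity constant. -/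
theorem exists_lacunary_syndetic (hfree : IsFree Ω) {L : ℝ} (hL : 0 < L) :
    ∃ M : Set Ω, MeasurableSet M ∧ IsLacunary L M ∧
      ∀ ω : Ω, ∃ r : ℝ, |r| < L + 1 ∧ r +ᵥ ω ∈ M := by
  obtain ⟨V, hV, hVL, hVm⟩ := exists_lacunary_family (Ω := Ω) hfree L
  obtain ⟨e, he⟩ := exists_surjective_nat (ℚ × ((ℕ × ℕ × Bool × ℚ × ℕ) × ℕ))
  obtain ⟨M, hM, -, hMind, hMmax⟩ := exists_measurableSet_independent
    (fun x y : Ω => ∃ r : ℝ, |r| < L ∧ r +ᵥ x = y)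
    (fun x => ⟨0, by simpa using hL, zero_vadd ℝ x⟩)
    (by
      rintro x _ ⟨r, hr, rfl⟩
      exact ⟨-r, by rwa [abs_neg], by rw [vadd_vadd, neg_add_cancel, zero_vadd]⟩)
    (by
      intro M hM hind
      have hlac : IsLacunary L M := by
        intro x hx r hr hrx
        by_contra h
        refine hind hx hrx (fun h' => hr.ne' (hfree r x h'.symm)) ⟨r, ?_, rfl⟩
        rw [abs_of_pos hr]
        linarith
      have : {x : Ω | ∃ y ∈ M, ∃ r : ℝ, |r| < L ∧ r +ᵥ x = y} =
          {y : Ω | ∃ r ∈ Ioo (-L) L, ∃ x ∈ M, r +ᵥ x = y} := by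
        ext x
        constructor
        · rintro ⟨_, hy, r, hr, rfl⟩
          refine ⟨-r, ?_, _, hy, by rw [vadd_vadd, neg_add_cancel, zero_vadd]⟩
          rw [← abs_neg] at hr
          exact abs_lt.1 hr
        · rintro ⟨r, hr, x, hx, rfl⟩
          exact ⟨x, hx, -r, by rw [abs_neg]; exact abs_lt.2 hr,
            by rw [vadd_vadd, neg_add_cancel, zero_vadd]⟩
      rw [this]
      exact hlac.measurableSet_thicken hL hM measurableSet_Ioo)
    (fun k => (fun x : Ω => ((e k).1 : ℝ) +ᵥ x) ⁻¹' V (e k).2)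
    (fun k => measurable_const_vadd _ (hV _))
    (by
      rintro k x hx _ hy hxy ⟨r, hr, rfl⟩
      have hr0 : r ≠ 0 := by
        rintro rfl
        exact hxy (zero_vadd ℝ x).symm
      refine absurd ((hVL (e k).2).le_abs hx hr0 ?_) (not_le.2 hr)
      rw [vadd_comm]
      exact hy)
  refine ⟨M, hM, ?_, fun ω => ?_⟩
  · intro x hx r hr hrx
    by_contra h
    refine hMind hx hrx (fun h' => hr.ne' (hfree r x h'.symm)) ⟨r, ?_, rfl⟩
    rw [abs_of_pos hr]
    linarith
  · obtain ⟨i, s, hs⟩ := hVm ω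
    -- Including the rational translates of the family puts a point of some member within time 1 of
    -- every ω; this is what bounds the gaps of M.
    obtain ⟨q, hq1, hq2⟩ := exists_rat_btwn (show s - 1 < s by linarith)
    obtain ⟨k, hk⟩ := he (q, i)
    obtain ⟨_, hy, r, hr, rfl⟩ := hMmax k ((s - q) +ᵥ ω) (by
      simp only [mem_preimage, hk, vadd_vadd]
      rwa [add_sub_cancel])
    refine ⟨r + (s - q), ?_, by rwa [← vadd_vadd]⟩
    rw [abs_lt] at hr ⊢
    constructor <;> linarith [hr.1, hr.2]

end BorelFlow

/-! ### Gaps, the successor automorphism and subdivision -/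

namespace BorelFlow

section Gap

variable {Ω : Type*} [AddAction ℝ Ω] {C : Set Ω}

theorem gap_eq {x : Ω} {g : ℝ} (hg : 0 < g) (hgx : g +ᵥ x ∈ C)
    (h : ∀ u, 0 < u → u < g → u +ᵥ x ∉ C) : gap C x = g := by
  refine IsLeast.csInf_eq ⟨⟨hg, hgx⟩, fun u hu => ?_⟩
  by_contra hlt
  exact h u hu.1 (not_le.1 hlt) hu.2

variable [MeasurableSpace Ω]

theorem IsLacunary.isCrossSection {c R : ℝ} (hc : 0 < c) (hC : IsLacunary c C)
    (hm : MeasurableSet C) (hR : ∀ ω : Ω, ∃ r : ℝ, |r| < R ∧ r +ᵥ ω ∈ C) : IsCrossSection C where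
  measurableSet := hm
  meets_orbit ω := by
    obtain ⟨r, -, hr⟩ := hR ω
    exact ⟨_, ⟨r, rfl⟩, hr⟩
  lacunary := ⟨c, hc, fun x hx r hr hrx => hC x hx r hr hrx.1⟩
  exists_after x hx := by
    obtain ⟨r, hr, hrx⟩ := hR (R +ᵥ x)
    refine ⟨r + R, by linarith [(abs_lt.1 hr).1], ?_⟩
    rwa [← vadd_vadd]
  exists_before x hx := by
    obtain ⟨r, hr, hrx⟩ := hR (-R +ᵥ x)
    refine ⟨R - r, by linarith [(abs_lt.1 hr).2], ?_⟩
    rwa [show -(R - r) = r + -R by ring, ← vadd_vadd]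

namespace IsCrossSection

variable (hC : IsCrossSection C) (hfree : IsFree Ω)

include hC hfree

theorem exists_isLacunary : ∃ c : ℝ, 0 < c ∧ IsLacunary c C := by
  obtain ⟨c, hc, h⟩ := hC.lacunary
  exact ⟨c, hc, fun x hx r hr hrx => h x hx r hr ⟨hrx, fun h' => hr.ne' (hfree r x h')⟩⟩

theorem gap_pos {x : Ω} (hx : x ∈ C) : 0 < gap C x := (hC.isLeast_gap hfree hx).1.1

theorem next_mem {x : Ω} (hx : x ∈ C) : next C x ∈ C := (hC.isLeast_gap hfree hx).1.2

theorem gap_le {x : Ω} (hx : x ∈ C) {r : ℝ} (hr : 0 < r) (hrx : r +ᵥ x ∈ C) : gap C x ≤ r :=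
  (hC.isLeast_gap hfree hx).2 ⟨hr, hrx⟩

/-- A point lies in at most one of the intervals between consecutive points of `C`. -/
theorem eq_of_vadd_eq {x x' : Ω} (hx : x ∈ C) (hx' : x' ∈ C) {u u' : ℝ} (hu : 0 ≤ u)
    (hu' : 0 ≤ u') (hux : u < gap C x) (hux' : u' < gap C x') (h : u +ᵥ x = u' +ᵥ x') :
    x = x' ∧ u = u' := by
  have h1 : (u - u') +ᵥ x = x' := by
    rw [sub_eq_neg_add, ← vadd_vadd, h, vadd_vadd, neg_add_cancel, zero_vadd]
  have h2 : (u' - u) +ᵥ x' = x := by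
    rw [sub_eq_neg_add, ← vadd_vadd, ← h, vadd_vadd, neg_add_cancel, zero_vadd]
  rcases lt_trichotomy u u' with hlt | rfl | hlt
  · have := hC.gap_le hfree hx' (sub_pos.2 hlt) (h2 ▸ hx)
    linarith
  · rw [sub_self, zero_vadd] at h1
    exact ⟨h1, rfl⟩
  · have := hC.gap_le hfree hx (sub_pos.2 hlt) (h1 ▸ hx')
    linarith

theorem next_injOn : InjOn (next C) C := by
  intro x hx x' hx' h
  wlog hle : gap C x ≤ gap C x' generalizing x x'
  · exact (this hx' hx h.symm (by linarith)).symm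
  have h1 : (gap C x' - gap C x) +ᵥ x' = x := by
    rw [sub_eq_neg_add, ← vadd_vadd]
    change -gap C x +ᵥ next C x' = x
    rw [← h, next, vadd_vadd, neg_add_cancel, zero_vadd]
  rcases hle.eq_or_lt with he | hlt
  · rw [he, sub_self, zero_vadd] at h1
    exact h1.symm
  · have := hC.gap_le hfree hx' (sub_pos.2 hlt) (by rwa [h1])
    linarith [hC.gap_pos hfree hx]

theorem exists_next_eq {x : Ω} (hx : x ∈ C) : ∃ y ∈ C, next C y = x := by
  obtain ⟨c, hc, hlac⟩ := hC.exists_isLacunary hfree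
  obtain ⟨r₀, hr₀, hr₀x⟩ := hC.exists_before x hx
  obtain ⟨r, ⟨hr, hrx⟩, hmax⟩ := exists_max_image _ id
    ((hlac.finite_returns hc x r₀).inter_of_right (Iio 0))
    ⟨-r₀, mem_Iio.2 (by linarith), by rw [abs_neg, abs_of_pos hr₀], hr₀x⟩
  rw [mem_Iio] at hr
  have hback : -r +ᵥ (r +ᵥ x) = x := by rw [vadd_vadd, neg_add_cancel, zero_vadd]
  have hg : gap C (r +ᵥ x) = -r := by
    refine gap_eq (by linarith) (by rwa [hback]) fun u hu hur hmem => ?_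
    rw [vadd_vadd] at hmem
    have habs := hrx.1
    rw [abs_of_neg hr] at habs
    have := hmax (u + r) ⟨mem_Iio.2 (by linarith), by rw [abs_of_neg] <;> linarith, hmem⟩
    simp only [id] at this
    linarith
  exact ⟨r +ᵥ x, hrx.2, by rw [next, hg, hback]⟩

variable [StandardBorelSpace Ω] [MeasurableVAdd₂ ℝ Ω]

/-- The gap at x is at most q exactly when x lies in a backward thickening of C by (0, q]. -/
theorem measurable_gap : Measurable fun x : C => gap C (x : Ω) := by
  obtain ⟨c, hc, hlac⟩ := hC.exists_isLacunary hfree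
  refine measurable_of_Iic fun q => ?_
  have : (fun x : C => gap C (x : Ω)) ⁻¹' Iic q =
      Subtype.val ⁻¹' {y : Ω | ∃ r ∈ Ico (-q) 0, ∃ x ∈ C, r +ᵥ x = y} := by
    ext ⟨x, hx⟩
    simp only [mem_preimage, mem_Iic, mem_ofPred_eq]
    constructor
    · intro h
      refine ⟨-gap C x, ⟨by linarith, by linarith [hC.gap_pos hfree hx]⟩, _,
        hC.next_mem hfree hx, ?_⟩
      rw [next, vadd_vadd, neg_add_cancel, zero_vadd]
    · rintro ⟨r, ⟨h1, h2⟩, y, hy, rfl⟩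
      refine (hC.gap_le hfree hx (by linarith : 0 < -r) ?_).trans (by linarith)
      rwa [vadd_vadd, neg_add_cancel, zero_vadd]
  rw [this]
  exact measurable_subtype_coe
    (hlac.measurableSet_thicken hc hC.measurableSet measurableSet_Ico)

/-- The induced automorphism of a cross section. -/
theorem exists_nextEquiv : ∃ T : C ≃ᵐ C, ∀ x : C, (T x : Ω) = next C x := by
  have : StandardBorelSpace C := hC.measurableSet.standardBorel
  let f : C → C := fun x => ⟨next C x, hC.next_mem hfree x.2⟩
  have hf : Measurable f :=
    ((hC.measurable_gap hfree).vadd measurable_subtype_coe).subtype_mk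
  have hinj : f.Injective := fun x y h =>
    Subtype.ext (hC.next_injOn hfree x.2 y.2 (congrArg Subtype.val h))
  have hsurj : f.Surjective := fun x => by
    obtain ⟨y, hy, h⟩ := hC.exists_next_eq hfree x.2
    exact ⟨⟨y, hy⟩, Subtype.ext h⟩
  refine ⟨⟨Equiv.ofBijective f ⟨hinj, hsurj⟩, hf, ?_⟩, fun x => rfl⟩
  intro s hs
  rw [← Equiv.image_eq_preimage_symm]
  exact (hf.measurableEmbedding hinj).measurableSet_image.2 hs

end IsCrossSection

end Gap

variable {Ω : Type*} [AddAction ℝ Ω] [MeasurableSpace Ω] [StandardBorelSpace Ω]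
  [MeasurableVAdd₂ ℝ Ω]

/-- Dividing each gap of `C` into `k` equal parts. -/
theorem IsCrossSection.exists_subdivision (hfree : IsFree Ω) {C : Set Ω} (hC : IsCrossSection C)
    {k : C → ℕ} (hk : Measurable k) (hk0 : ∀ x, 0 < k x) {lo R : ℝ} (hlo : 0 < lo)
    (hlok : ∀ x : C, lo ≤ gap C (x : Ω) / k x)
    (hR : ∀ ω : Ω, ∃ r : ℝ, |r| < R ∧ r +ᵥ ω ∈ C) :
    ∃ D : Set Ω, IsCrossSection D ∧ ∀ y ∈ D, ∃ x : C, gap D y = gap C (x : Ω) / k x := by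
  have hstd : StandardBorelSpace C := hC.measurableSet.standardBorel
  let w : C → ℝ := fun x => gap C (x : Ω) / k x
  have hkw : ∀ x, k x * w x = gap C (x : Ω) := fun x =>
    mul_div_cancel₀ _ (Nat.cast_ne_zero.2 (hk0 x).ne')
  have hw : ∀ x, 0 < w x := fun x => hlo.trans_le (hlok x)
  have hlt : ∀ (x : C) (a : ℝ), a < k x → a * w x < gap C (x : Ω) := fun x a ha => by
    rw [← hkw]
    exact mul_lt_mul_of_pos_right ha (hw x)
  have hwm : Measurable w :=
    (hC.measurable_gap hfree).div (measurable_from_top.comp hk)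
  let D : Set Ω := ⋃ j : ℕ, (fun x : C => ((j : ℝ) * w x) +ᵥ (x : Ω)) '' {x | j < k x}
  have hDm : MeasurableSet D := by
    refine MeasurableSet.iUnion fun j => MeasurableSet.image_of_measurable_injOn
      (hk measurableSet_Ioi) ((hwm.const_mul _).vadd measurable_subtype_coe) ?_
    intro x hx x' hx' h
    exact Subtype.ext (hC.eq_of_vadd_eq hfree x.2 x'.2 (by have := hw x; positivity)
      (by have := hw x'; positivity) (hlt x j (Nat.cast_lt.2 hx)) (hlt x' j (Nat.cast_lt.2 hx')) h).1
  have hCD : C ⊆ D := fun x hx =>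
    mem_iUnion.2 ⟨0, ⟨x, hx⟩, hk0 _, by simp⟩
  have hfar : ∀ (x : C) (j : ℕ), j < k x → ∀ u, 0 < u → u < w x →
      u +ᵥ (((j : ℝ) * w x) +ᵥ (x : Ω)) ∉ D := by
    intro x j hj u hu hux hmem
    obtain ⟨j', x', hj', h⟩ := mem_iUnion.1 hmem
    have hj1 : (j : ℝ) + 1 ≤ k x := by exact_mod_cast hj
    simp only [vadd_vadd] at h
    have hwx := hw x
    have h1 : u + j * w x < gap C (x : Ω) := by
      have := mul_le_mul_of_nonneg_right hj1 hwx.le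
      rw [hkw] at this
      linarith
    obtain ⟨hxx, he⟩ := hC.eq_of_vadd_eq hfree x.2 x'.2 (by positivity)
      (by have := hw x'; positivity) h1 (hlt x' j' (Nat.cast_lt.2 hj')) h.symm
    obtain rfl : x = x' := Subtype.ext hxx
    have h2 : (j : ℝ) < j' := lt_of_mul_lt_mul_right (by linarith) hwx.le
    have h3 : (j : ℝ) + 1 ≤ j' := by exact_mod_cast (Nat.cast_lt.1 h2 : j < j')
    have := mul_le_mul_of_nonneg_right h3 hwx.le
    linarith
  have hgap : ∀ (x : C) (j : ℕ), j < k x → gap D (((j : ℝ) * w x) +ᵥ (x : Ω)) = w x := by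
    intro x j hj
    refine gap_eq (hw x) ?_ (hfar x j hj)
    rw [vadd_vadd]
    rcases Nat.lt_or_ge (j + 1) (k x) with h | h
    · exact mem_iUnion.2 ⟨j + 1, x, h, by push_cast; ring_nf⟩
    · have : w x + j * w x = gap C (x : Ω) := by
        rw [← hkw x, show k x = j + 1 by omega]
        push_cast
        ring
      rw [this]
      exact hCD (hC.next_mem hfree x.2)
  have hDlac : IsLacunary lo D := by
    intro y hy r hr hry
    obtain ⟨j, x, hj, rfl⟩ := mem_iUnion.1 hy
    by_contra h
    exact hfar x j hj r hr ((not_le.1 h).trans_le (hlok x)) hry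
  refine ⟨D, hDlac.isCrossSection hlo hDm (R := R) fun ω => ?_, fun y hy => ?_⟩
  · obtain ⟨r, hr, hrC⟩ := hR ω
    exact ⟨r, hr, hCD hrC⟩
  · obtain ⟨j, x, hj, rfl⟩ := mem_iUnion.1 hy
    exact ⟨x, hgap x j hj⟩

theorem exists_isCrossSection_gap_mem_Icc (hfree : IsFree Ω) {lo hi : ℝ} (hlo : 0 < lo)
    (hlohi : lo < hi) :
    ∃ C : Set Ω, IsCrossSection C ∧ ∀ x ∈ C, lo ≤ gap C x ∧ gap C x ≤ hi := by
  have hhi : 0 < hi := hlo.trans hlohi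
  have hd : 0 < hi - lo := sub_pos.2 hlohi
  -- For g ≥ lo·hi/(hi − lo), cutting g into ⌈g/hi⌉ equal parts gives parts of length at least lo.
  obtain ⟨M, hM, hMlac, hMR⟩ := exists_lacunary_syndetic (Ω := Ω) hfree
    (L := lo * hi / (hi - lo)) (by positivity)
  have hC : IsCrossSection M := hMlac.isCrossSection (by positivity) hM hMR
  have hL : ∀ x : M, lo * hi ≤ gap M (x : Ω) * (hi - lo) := fun x => by
    rw [← div_le_iff₀ hd]
    exact hMlac x x.2 _ (hC.gap_pos hfree x.2) (hC.next_mem hfree x.2)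
  let k : M → ℕ := fun x => ⌈gap M (x : Ω) / hi⌉₊
  have hk0 : ∀ x, 0 < k x := fun x => Nat.ceil_pos.2 (div_pos (hC.gap_pos hfree x.2) hhi)
  have hk : Measurable k :=
    Nat.measurable_ceil.comp ((hC.measurable_gap hfree).div_const hi)
  have hbd : ∀ x : M, lo ≤ gap M (x : Ω) / k x ∧ gap M (x : Ω) / k x ≤ hi := by
    intro x
    have hkx : (0 : ℝ) < k x := Nat.cast_pos.2 (hk0 x)
    have hg := hC.gap_pos hfree x.2
    constructor
    · have h1 : (k x : ℝ) < gap M (x : Ω) / hi + 1 := Nat.ceil_lt_add_one (by positivity)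
      have h2 : gap M (x : Ω) / hi * hi = gap M (x : Ω) := div_mul_cancel₀ _ hhi.ne'
      have h3 := mul_lt_mul_of_pos_right h1 (mul_pos hlo hhi)
      have h4 : (gap M (x : Ω) / hi + 1) * (lo * hi) = lo * gap M (x : Ω) + lo * hi := by
        rw [add_mul, mul_comm lo hi, ← mul_assoc, h2]
        ring
      rw [le_div_iff₀ hkx]
      have h5 : hi * (lo * k x) ≤ hi * gap M (x : Ω) := by linarith [hL x]
      exact le_of_mul_le_mul_left h5 hhi
    · have h1 : gap M (x : Ω) / hi ≤ k x := Nat.le_ceil _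
      rw [div_le_iff₀ hhi] at h1
      rw [div_le_iff₀ hkx]
      linarith
  obtain ⟨D, hD, hDg⟩ := hC.exists_subdivision hfree hk hk0 hlo (fun x => (hbd x).1) hMR
  refine ⟨D, hD, fun y hy => ?_⟩
  obtain ⟨x, hx⟩ := hDg y hy
  rw [hx]
  exact hbd x

end BorelFlow

/-! ### Displacing the cross section and conclusion -/

namespace BorelFlow

variable {Ω : Type*} [AddAction ℝ Ω]

theorem natCast_le_encard_block {S : Set ℝ} {C : Set Ω} {y : ℕ → Ω} (hy : ∀ j, y j ∈ C)
    (hinj : y.Injective) (hnext : ∀ j, next C (y j) = y (j + 1)) {n : ℕ}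
    (hgap : ∀ j < n, gap C (y j) ∈ S) : (n : ℕ∞) ≤ (block S C (y 0)).encard := by
  have hit : ∀ j, (next C)^[j] (y 0) = y j := by
    intro j
    induction j with
    | zero => rfl
    | succ j ih => rw [Function.iterate_succ_apply', ih, hnext]
  have hsub : y '' (Finset.range n : Set ℕ) ⊆ block S C (y 0) := by
    rintro _ ⟨j, hj, rfl⟩
    have hjn : j < n := Finset.mem_range.1 hj
    refine ⟨hy 0, hy j, Or.inl ⟨j, hit j, fun k hk => ?_⟩⟩
    rw [hit]
    exact hgap k (hk.trans hjn)
  refine le_trans (le_of_eq ?_) (encard_le_encard hsub)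
  rw [hinj.encard_image, encard_coe_eq_coe_finsetCard, Finset.card_range]

variable [MeasurableSpace Ω]

theorem IsCrossSection.exists_iterate_next (hfree : IsFree Ω) {C : Set Ω} (hC : IsCrossSection C)
    (T : C ≃ᵐ C) (hT : ∀ x : C, (T x : Ω) = next C x) (x : C) (n : ℕ) :
    ∃ r : ℝ, (n = 0 ∨ 0 < r) ∧ ((⇑T)^[n] x : Ω) = r +ᵥ (x : Ω) := by
  induction n with
  | zero => exact ⟨0, Or.inl rfl, (zero_vadd ℝ _).symm⟩
  | succ n ih =>
    obtain ⟨r, hr, h⟩ := ih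
    refine ⟨gap C ((⇑T)^[n] x : Ω) + r, Or.inr ?_, ?_⟩
    · have := hC.gap_pos hfree ((⇑T)^[n] x).2
      rcases hr with rfl | hr
      · obtain rfl : r = 0 := hfree r x h.symm
        simpa using this
      · linarith
    · rw [Function.iterate_succ_apply', hT, next, ← vadd_vadd, ← h]

theorem IsCrossSection.iterate_next_ne (hfree : IsFree Ω) {C : Set Ω} (hC : IsCrossSection C)
    (T : C ≃ᵐ C) (hT : ∀ x : C, (T x : Ω) = next C x) (x : C) (n : ℕ) (hn : 0 < n) :
    (⇑T)^[n] x ≠ x := by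
  intro h
  obtain ⟨r, hr, hrx⟩ := hC.exists_iterate_next hfree T hT x n
  rw [h] at hrx
  have := hfree r x hrx.symm
  rcases hr with rfl | hr
  · exact lt_irrefl 0 hn
  · exact hr.ne' this

/-- A cross section stays one when its points are moved by less than a quarter of the gaps, and its
gaps change by the difference of the displacements. -/
theorem IsCrossSection.displace [StandardBorelSpace Ω] [MeasurableVAdd₂ ℝ Ω] (hfree : IsFree Ω)
    {C : Set Ω} (hC : IsCrossSection C) (T : C ≃ᵐ C) (hT : ∀ x : C, (T x : Ω) = next C x)
    {f : C → ℝ} (hf : Measurable f) {κ : ℝ} (hfκ : ∀ x, |f x| ≤ κ)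
    (hgap : ∀ x ∈ C, 4 * κ < gap C x) :
    IsCrossSection (range fun x : C => f x +ᵥ (x : Ω)) ∧
      Function.Injective (fun x : C => f x +ᵥ (x : Ω)) ∧
      (∀ x : C, gap (range fun x : C => f x +ᵥ (x : Ω)) (f x +ᵥ (x : Ω)) =
        gap C (x : Ω) + f (T x) - f x) ∧
      ∀ x : C, next (range fun x : C => f x +ᵥ (x : Ω)) (f x +ᵥ (x : Ω)) =
        f (T x) +ᵥ (T x : Ω) := by
  have hstd : StandardBorelSpace C := hC.measurableSet.standardBorel
  let P : C → Ω := fun x => f x +ᵥ (x : Ω)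
  let g : C → ℝ := fun x => gap C (x : Ω) + f (T x) - f x
  have hf' : ∀ x, -κ ≤ f x ∧ f x ≤ κ := fun x => abs_le.1 (hfκ x)
  obtain ⟨c, hc, hlac⟩ := hC.exists_isLacunary hfree
  have hg : ∀ x, c / 2 ≤ g x := fun x => by
    have h1 := hlac x x.2 _ (hC.gap_pos hfree x.2) (hC.next_mem hfree x.2)
    have h2 := hgap x x.2
    have h3 := hf' x
    have h4 := hf' (T x)
    simp only [g]
    linarith
  have hstep : ∀ x, g x +ᵥ P x = P (T x) := fun x => by
    simp only [g, P, hT, next, vadd_vadd]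
    congr 1
    ring
  -- Displacements alter distances by at most 2κ, less than half of any gap, so the order of points
  -- is kept and no displaced point falls between neighbours.
  have key : ∀ (x x' : C) (u : ℝ), 0 ≤ u → u +ᵥ P x = P x' → (u = 0 ∧ x = x') ∨ g x ≤ u := by
    intro x x' u hu h
    have hr : (u + f x - f x') +ᵥ (x : Ω) = x' := by
      rw [show u + f x - f x' = -f x' + (u + f x) by ring, ← vadd_vadd, ← vadd_vadd]
      change -f x' +ᵥ (u +ᵥ P x) = x'
      rw [h, vadd_vadd, neg_add_cancel, zero_vadd]
    have h1 := hf' x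
    have h2 := hf' x'
    have h3 := hf' (T x)
    rcases lt_trichotomy (u + f x - f x') 0 with hr0 | hr0 | hr0
    · have h4 := hC.gap_le hfree x'.2 (neg_pos.2 hr0)
        (by rw [← hr, vadd_vadd, neg_add_cancel, zero_vadd]; exact x.2)
      have := hgap x' x'.2
      linarith
    · rw [hr0, zero_vadd] at hr
      obtain rfl : x = x' := Subtype.ext hr
      exact Or.inl ⟨by linarith, rfl⟩
    · right
      have h4 := hC.gap_le hfree x.2 hr0 (by rw [hr]; exact x'.2)
      rcases h4.eq_or_lt with h5 | h5
      · have : T x = x' := Subtype.ext (by rw [hT, next, h5, hr])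
        simp only [g, this]
        linarith
      · have h6 := hC.gap_le hfree (hC.next_mem hfree x.2) (sub_pos.2 h5) (by
          rw [next, vadd_vadd, sub_add_cancel, hr]
          exact x'.2)
        have h7 := hgap _ (hC.next_mem hfree x.2)
        simp only [g]
        linarith
  have hinj : Function.Injective P := fun x x' h => by
    rcases key x x' 0 le_rfl (by rwa [zero_vadd]) with h' | h'
    · exact h'.2
    · linarith [hg x]
  have hPgap : ∀ x, gap (range P) (P x) = g x := by
    intro x
    refine gap_eq (by linarith [hg x]) (hstep x ▸ mem_range_self (T x)) fun u hu hux => ?_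
    rintro ⟨x', hx'⟩
    rcases key x x' u hu.le hx'.symm with h' | h'
    · exact hu.ne' h'.1
    · linarith
  refine ⟨⟨?_, ?_, ⟨c / 2, by linarith, ?_⟩, ?_, ?_⟩, hinj, hPgap, fun x => ?_⟩
  · rw [← image_univ]
    exact MeasurableSet.univ.image_of_measurable_injOn (hf.vadd measurable_subtype_coe) hinj.injOn
  · intro ω
    obtain ⟨_, ⟨r, rfl⟩, hr⟩ := hC.meets_orbit ω
    exact ⟨_, ⟨f ⟨_, hr⟩ + r, (vadd_vadd _ _ _).symm⟩, ⟨_, hr⟩, rfl⟩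
  · rintro _ ⟨x, rfl⟩ r hr ⟨⟨x', hx'⟩, -⟩
    rcases key x x' r hr.le hx'.symm with h' | h'
    · exact absurd h'.1 hr.ne'
    · exact (hg x).trans h'
  · rintro _ ⟨x, rfl⟩
    exact ⟨g x, by linarith [hg x], T x, (hstep x).symm⟩
  · rintro _ ⟨x, rfl⟩
    refine ⟨g (T.symm x), by linarith [hg (T.symm x)], T.symm x, ?_⟩
    have h := hstep (T.symm x)
    rw [T.apply_symm_apply] at h
    change P (T.symm x) = -g (T.symm x) +ᵥ P x
    rw [← h, vadd_vadd, neg_add_cancel, zero_vadd]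
  · change gap (range P) (P x) +ᵥ P x = P (T x)
    rw [hPgap, hstep]

/-- A positive null sequence takes values along a sequence that decreases fourfold. -/
theorem exists_rapid_subsequence {a : ℕ → ℝ} (ha : ∀ n, 0 < a n) (ha0 : Tendsto a atTop (𝓝 0))
    {ε : ℝ} (hε : 0 < ε) :
    ∃ s : ℕ → ℝ, (∀ n, 0 < s n) ∧ (∀ n, s (n + 1) ≤ s n / 4) ∧ s 0 ≤ ε ∧
      ∀ n, s n ∈ range a := by
  have h : ∀ e : ℝ, 0 < e → ∃ m, a m ≤ e := fun e he =>
    (ha0.eventually_le_const he).exists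
  choose! m hm using h
  let u : ℕ → ℕ := fun n => Nat.rec (m ε) (fun _ k => m (a k / 4)) n
  refine ⟨fun n => a (u n), fun n => ha _, fun n => ?_, hm ε hε, fun n => mem_range_self _⟩
  exact hm (a (u n) / 4) (by linarith [ha (u n)])

/-- The sign σ treats approach to υ from above and from below together. -/
theorem exists_hasArbitrarilyLargeBlocks [StandardBorelSpace Ω] [MeasurableVAdd₂ ℝ Ω]
    (hfree : IsFree Ω) {υ : ℝ} (hυ : 0 < υ) {σ : ℝ} (hσ : σ = 1 ∨ σ = -1) {a : ℕ → ℝ}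
    (ha : ∀ n, 0 < a n) (ha0 : Tendsto a atTop (𝓝 0)) :
    ∃ C : Set Ω, IsCrossSection C ∧
      HasArbitrarilyLargeBlocks (range fun n => υ + σ * a n) C := by
  -- With s(0) ≤ υ/16 and |H| ≤ 2 s(0), four times the displacement is at most υ/2, below every gap.
  obtain ⟨s, hs, hs4, hs0, hsa⟩ := exists_rapid_subsequence ha ha0 (show 0 < υ / 16 by linarith)
  have e0 := hs4 0
  have e1 := hs4 1
  have e2 := hs 2
  simp only [zero_add, Nat.reduceAdd] at e0 e1
  have hσσ : σ * σ = 1 := by rcases hσ with rfl | rfl <;> norm_num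
  have hσabs : |σ| = 1 := by rcases hσ with rfl | rfl <;> norm_num
  obtain ⟨C, hC, hCg⟩ : ∃ C : Set Ω, IsCrossSection C ∧
      ∀ x ∈ C, s 2 ≤ σ * (gap C x - υ) ∧ σ * (gap C x - υ) ≤ s 1 := by
    rcases hσ with rfl | rfl
    · obtain ⟨C, hC, h⟩ := exists_isCrossSection_gap_mem_Icc (Ω := Ω) hfree (lo := υ + s 2)
        (hi := υ + s 1) (by linarith) (by linarith)
      exact ⟨C, hC, fun x hx => ⟨by linarith [(h x hx).1], by linarith [(h x hx).2]⟩⟩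
    · obtain ⟨C, hC, h⟩ := exists_isCrossSection_gap_mem_Icc (Ω := Ω) hfree (lo := υ - s 1)
        (hi := υ - s 2) (by linarith) (by linarith)
      exact ⟨C, hC, fun x hx => ⟨by linarith [(h x hx).2], by linarith [(h x hx).1]⟩⟩
  have : StandardBorelSpace C := hC.measurableSet.standardBorel
  obtain ⟨T, hT⟩ := hC.exists_nextEquiv hfree
  obtain ⟨H, hH, hHs, hHr⟩ := exists_coboundary T (hC.iterate_next_ne hfree T hT) hs hs4
    (δ := fun x : C => σ * (gap C (x : Ω) - υ))
    (((hC.measurable_gap hfree).sub_const υ).const_mul σ) (fun x => hCg x x.2)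
  have hlow : ∀ x ∈ C, 4 * (2 * s 0) < gap C x := by
    intro x hx
    obtain ⟨h1, h2⟩ := hCg x hx
    rcases hσ with rfl | rfl <;> linarith
  obtain ⟨hD, hDinj, hDgap, hDnext⟩ := hC.displace hfree T hT (hH.const_mul σ) (κ := 2 * s 0)
    (fun x => by rw [abs_mul, hσabs, one_mul]; exact hHs x) hlow
  refine ⟨_, hD, fun ω n => ?_⟩
  obtain ⟨_, ⟨r, rfl⟩, hr⟩ := hC.meets_orbit ω
  set x₀ : C := ⟨_, hr⟩ with hx₀
  obtain ⟨m, hm⟩ := hHr x₀ n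
  let z : ℕ → C := fun j => (⇑T)^[j + m] x₀
  have hz : ∀ i j, (⇑T)^[i] (z j) = z (i + j) := fun i j => by
    simp only [z, ← Function.iterate_add_apply, add_assoc]
  have hinjz : z.Injective := by
    intro i j h
    by_contra hne
    wlog hij : i < j generalizing i j
    · exact this h.symm (Ne.symm hne) (by omega)
    refine hC.iterate_next_ne hfree T hT (z i) (j - i) (by omega) ?_
    rw [hz, Nat.sub_add_cancel hij.le, h]
  let y : ℕ → Ω := fun j => σ * H (z j) +ᵥ (z j : Ω)
  refine ⟨y 0, ⟨?_, z 0, rfl⟩, natCast_le_encard_block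
    (C := range fun x : C => σ * H x +ᵥ (x : Ω)) (y := y) (fun j => ⟨z j, rfl⟩)
    (hDinj.comp hinjz) (fun j => ?_) fun j hj => ?_⟩
  · obtain ⟨r', -, hr'⟩ := hC.exists_iterate_next hfree T hT x₀ (0 + m)
    refine ⟨σ * H (z 0) + r' + r, ?_⟩
    change (σ * H (z 0) + r' + r) +ᵥ ω = σ * H (z 0) +ᵥ ((⇑T)^[0 + m] x₀ : Ω)
    rw [hr', add_assoc, ← vadd_vadd, ← vadd_vadd]
  · change next _ (σ * H (z j) +ᵥ (z j : Ω)) = σ * H (z (j + 1)) +ᵥ (z (j + 1) : Ω)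
    rw [hDnext (z j), add_comm j 1, ← hz 1 j, Function.iterate_one]
  · obtain ⟨i, hi⟩ := hm j hj
    obtain ⟨k, hk⟩ := hsa i
    refine ⟨k, ?_⟩
    change υ + σ * a k = gap _ (σ * H (z j) +ᵥ (z j : Ω))
    rw [hDgap (z j), hk, hi]
    linear_combination (gap C (z j : Ω) - υ) * hσσ

end BorelFlow

theorem theorem3p5 {Ω : Type*} [MeasurableSpace Ω] [StandardBorelSpace Ω]
    [AddAction ℝ Ω] [MeasurableVAdd₂ ℝ Ω] (hfree : BorelFlow.IsFree Ω)
    (υ : ℝ) (hυ : 0 < υ) (t : ℕ → ℝ) (ht : StrictMono t ∨ StrictAnti t)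
    (ht0 : Tendsto t atTop (𝓝 0)) (hpos : 0 < υ + t 0) :
    ∃ C : Set Ω, BorelFlow.IsCrossSection C ∧
      BorelFlow.HasArbitrarilyLargeBlocks (Set.range fun m : ℕ => υ + t m) C := by
  rcases ht with ht | ht
  · have hneg : ∀ n, t n < 0 := fun n =>
      (ht n.lt_succ_self).trans_le (ht.monotone.ge_of_tendsto ht0 _)
    have h0 : Tendsto (fun n => -t n) atTop (𝓝 0) := by simpa using ht0.neg
    simpa using BorelFlow.exists_hasArbitrarilyLargeBlocks hfree hυ (Or.inr rfl)
      (fun n => neg_pos.2 (hneg n)) h0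
  · have hp : ∀ n, 0 < t n := fun n =>
      (ht.antitone.le_of_tendsto ht0 _).trans_lt (ht n.lt_succ_self)
    simpa using BorelFlow.exists_hasArbitrarilyLargeBlocks hfree hυ (Or.inl rfl) hp ht0
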